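/- Let $\Omega=\{x\in\mathbb R^2:|x|<1\}$ and $\Omega'=\,]{-1},1[\,\times S^1$, where $S^1$ is identified with $[-\pi,\pi[$ via $\vartheta(\varphi)=(\cos\varphi,\sin\varphi)$ and carries the arc length measure. All functions are real-valued, and functions on $\Omega$ and $\Omega'$ are extended by zero. The backprojection $\mathcal R^*:L^2(\Omega')\to L^2(\Omega)$ is the bounded operator $$[\mathcal R^*g](x)=\int_{[-\pi,\pi[}g\bigl(x\cdot\vartheta(\varphi),\varphi\bigr)\,d\varphi .$$ A discretization consists of - a detector width $\delta_s>0$ and offsets $s_p=\delta_s\bigl(p-\tfrac{P+1}2\bigr)$, $p=1,\dots,P$, with $S_p=s_p+[-\delta_s/2,\delta_s/2[$; - angles $-\pi\le\varphi_1<\dots<\varphi_Q<\pi$ with $Q\ge 1$, $\varphi_0=\varphi_Q-2\pi$, $\varphi_{Q+1}=\varphi_1+2\pi$, the cells $\Phi_q=\bigl[\tfrac{\varphi_{q-1}+\varphi_q}2,\tfrac{\varphi_q+\varphi_{q+1}}2\bigr[$ taken modulo $2\pi$, and $\delta_\varphi=\max_{1\le q\le Q}(\varphi_{q+1}-\varphi_q)$;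 - a pixel size $\delta_x>0$ and pixel centers $x_{ij}=\delta_x\bigl(i-\tfrac{N+1}2,\,j-\tfrac{M+1}2\bigr)$, $1\le i\le N$, $1\le j\le M$, with pixels $X_{ij}=x_{ij}+[-\delta_x/2,\delta_x/2[^2$. It is assumed to be compatible with $\Omega$ and $\Omega'$: $\Omega\subset\bigcup_{i,j}X_{ij}$ and $\Omega'\subset\bigcup_{p,q}S_p\times\Phi_q$. With $w_{\delta_s}(t)=\max(0,\delta_s-|t|)$ and $f_{ij}=\delta_x^{-2}\int_{X_{ij}}f(x)\,dx$, the fully discrete (pixel-driven) Radon transform $\mathcal R^{\delta_x}_{\delta_s,\delta_\varphi}:L^2(\Omega)\to L^2(\Omega')$ is $$[\mathcal R^{\delta_x}_{\delta_s,\delta_\varphi}f](s,\varphi)=\frac{\delta_x^2}{\delta_s^2}\sum_{p=1}^P\sum_{q=1}^Q\chi_{S_p}(s)\,\chi_{\Phi_q}(\varphi)\sum_{i=1}^N\sum_{j=1}^M w_{\delta_s}\bigl(x_{ij}\cdot\vartheta(\varphi_q)-s_p\bigr)f_{ij}.$$ **Corollary.** Consider a family of compatible discretizations for which $\delta_s\to0$,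 $\frac{\delta_\varphi}{\delta_s}\to0$ and $\frac{\delta_x}{\delta_s}\to0$. Then the adjoints $(\mathcal R^{\delta_x}_{\delta_s,\delta_\varphi})^*$ converge to $\mathcal R^*$ in the operator norm of bounded linear maps $L^2(\Omega')\to L^2(\Omega)$. If additionally $\delta_\varphi=\mathcal O(\delta_s^{1+\epsilon})$ and $\delta_x=\mathcal O(\delta_s^{1+\epsilon})$ for some $0<\epsilon\le\frac12$, then $$\bigl\|(\mathcal R^{\delta_x}_{\delta_s,\delta_\varphi})^*-\mathcal R^*\bigr\|=\mathcal O(\delta_s^\epsilon)\qquad\text{as }\delta_s\to0 .$$ -/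

import Mathlib

open MeasureTheory Filter Topology Asymptotics

noncomputable section

namespace PixelRadon

/-- The Euclidean plane. -/
abbrev Plane : Type := EuclideanSpace ℝ (Fin 2)

/-- The image domain: the open Euclidean unit disc. -/
def Omega : Set Plane := Metric.ball 0 1

/-- The sinogram domain `]-1,1[ × S¹`, the circle being identified with `[-π, π[` through
the angle, so that its arc length measure is the Lebesgue measure. -/
def Omega' : Set (ℝ × ℝ) := Set.Ioo (-1) 1 ×ˢ Set.Ico (-Real.pi) Real.pi

/-- `L²(Ω)`. -/
abbrev L2Omega : Type := Lp ℝ 2 ((volume : Measure Plane).restrict Omega)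

/-- `L²(Ω')`. -/
abbrev L2Omega' : Type := Lp ℝ 2 ((volume : Measure (ℝ × ℝ)).restrict Omega')

/-- The unit vector with angle `φ`. -/
def theta (φ : ℝ) : Plane := !₂[Real.cos φ, Real.sin φ]

/-! ### The backprojection -/

/-- The backprojection of `g`, extended by zero outside `Ω'`. -/
def backprojectionFun (g : ℝ × ℝ → ℝ) (x : Plane) : ℝ :=
  ∫ φ in Set.Ico (-Real.pi) Real.pi, Omega'.indicator g (inner ℝ x (theta φ), φ)

theorem measurableSet_Omega : MeasurableSet Omega := measurableSet_ball

theorem measurableSet_Omega' : MeasurableSet Omega' := measurableSet_Ioo.prod measurableSet_Ico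

instance : IsFiniteMeasure ((volume : Measure Plane).restrict Omega) :=
  ⟨by simp [Omega]⟩

theorem restrict_Omega' : (volume : Measure (ℝ × ℝ)).restrict Omega' =
    ((volume : Measure ℝ).restrict (Set.Ioo (-1) 1)).prod
      ((volume : Measure ℝ).restrict (Set.Ico (-Real.pi) Real.pi)) := by
  rw [Measure.prod_restrict]; rfl

instance : IsFiniteMeasure ((volume : Measure (ℝ × ℝ)).restrict Omega') := by
  rw [restrict_Omega']; infer_instance

theorem inner_theta (x : Plane) (φ : ℝ) :
    inner ℝ x (theta φ) = Real.cos φ * x 0 + Real.sin φ * x 1 := by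
  simp [theta, PiLp.inner_apply, Fin.sum_univ_two]

theorem mem_Omega {x : Plane} : x ∈ Omega ↔ x 0 ^ 2 + x 1 ^ 2 < 1 := by
  rw [Omega, mem_ball_zero_iff, EuclideanSpace.norm_eq, Real.sqrt_lt' one_pos]
  simp [Fin.sum_univ_two]

theorem inner_theta_mem {x : Plane} (hx : x ∈ Omega) (φ : ℝ) :
    inner ℝ x (theta φ) ∈ Set.Ioo (-1 : ℝ) 1 := by
  rw [mem_Omega] at hx
  rw [inner_theta]
  have h := Real.sin_sq_add_cos_sq φ
  have : (Real.cos φ * x 0 + Real.sin φ * x 1) ^ 2 < 1 := by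
    nlinarith [sq_nonneg (Real.sin φ * x 0 - Real.cos φ * x 1)]
  exact abs_lt.1 ((sq_lt_one_iff_abs_lt_one _).1 this)

theorem measurable_theta : Measurable theta := by
  unfold theta
  apply Continuous.measurable
  fun_prop

/-- The map `(x, φ) ↦ (x · θ(φ), φ)`. -/
def proj (z : Plane × ℝ) : ℝ × ℝ := (inner ℝ z.1 (theta z.2), z.2)

theorem measurable_proj : Measurable proj := by
  unfold proj
  exact (measurable_fst.inner (measurable_theta.comp measurable_snd)).prodMk measurable_snd

theorem strip_le (φ : ℝ) {A : Set ℝ} (hA : MeasurableSet A) :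
    (volume : Measure Plane).restrict Omega {x | inner ℝ x (theta φ) ∈ A} ≤
      2 * (volume : Measure ℝ).restrict (Set.Ioo (-1) 1) A := by
  have hms : MeasurableSet {x : Plane | inner ℝ x (theta φ) ∈ A} :=
    (measurable_id.inner_const) hA
  rw [Measure.restrict_apply hms, Measure.restrict_apply hA]
  let M : Matrix (Fin 2) (Fin 2) ℝ :=
    !![Real.cos φ, Real.sin φ; -Real.sin φ, Real.cos φ]
  have hdet : M.det = 1 := by
    have h := Real.sin_sq_add_cos_sq φ
    simp only [M, Matrix.det_fin_two_of]
    linarith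
  have hmap := Real.map_matrix_volume_pi_eq_smul_volume_pi (M := M) (by simp [hdet])
  rw [hdet] at hmap
  simp only [inv_one, abs_one, ENNReal.ofReal_one, one_smul] at hmap
  have hmeas : Measurable (Matrix.toLin' M) :=
    (Matrix.toLin' M).continuous_of_finiteDimensional.measurable
  have hmp : MeasurePreserving (fun x : Plane => Matrix.toLin' M x.ofLp) volume volume :=
    MeasurePreserving.comp ⟨hmeas, hmap⟩ (PiLp.volume_preserving_ofLp (Fin 2))
  let S : Fin 2 → Set ℝ := ![A ∩ Set.Ioo (-1) 1, Set.Ioo (-1) 1]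
  have hS : MeasurableSet (Set.univ.pi S) := by
    refine MeasurableSet.univ_pi fun i => ?_
    fin_cases i
    · exact hA.inter measurableSet_Ioo
    · exact measurableSet_Ioo
  have hsub : {x : Plane | inner ℝ x (theta φ) ∈ A} ∩ Omega ⊆
      (fun x : Plane => Matrix.toLin' M x.ofLp) ⁻¹' Set.univ.pi S := by
    rintro x ⟨hx, hxO⟩
    have h1 := inner_theta_mem hxO φ
    have h2 := inner_theta_mem hxO (φ + Real.pi / 2)
    simp only [Set.mem_ofPred_eq] at hx
    rw [inner_theta] at hx h1 h2
    rw [Real.cos_add_pi_div_two, Real.sin_add_pi_div_two] at h2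
    intro i _
    fin_cases i
    · simpa [S, M, Matrix.toLin'_apply, Matrix.mulVec, dotProduct, Fin.sum_univ_two]
        using ⟨hx, h1⟩
    · simpa [S, M, Matrix.toLin'_apply, Matrix.mulVec, dotProduct, Fin.sum_univ_two] using h2
  calc volume ({x : Plane | inner ℝ x (theta φ) ∈ A} ∩ Omega)
      ≤ volume ((fun x : Plane => Matrix.toLin' M x.ofLp) ⁻¹' Set.univ.pi S) :=
        measure_mono hsub
    _ = volume (Set.univ.pi S) := hmp.measure_preimage hS.nullMeasurableSet
    _ = 2 * volume (A ∩ Set.Ioo (-1) 1) := by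
        rw [volume_pi_pi, Fin.prod_univ_two]
        simp only [S, Matrix.cons_val_zero, Matrix.cons_val_one, Real.volume_Ioo]
        rw [mul_comm]
        norm_num

theorem const_ne_top : ENNReal.ofReal (2 * Real.pi) ^ (1 / 2 : ℝ) ≠ ⊤ :=
  ENNReal.rpow_ne_top_of_nonneg (by norm_num) ENNReal.ofReal_ne_top

theorem map_proj_le :
    (((volume : Measure Plane).restrict Omega).prod
      ((volume : Measure ℝ).restrict (Set.Ico (-Real.pi) Real.pi))).map proj ≤
      (2 : ENNReal) • (volume : Measure (ℝ × ℝ)).restrict Omega' := by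
  refine Measure.le_iff.2 fun s hs => ?_
  rw [Measure.map_apply measurable_proj hs, Measure.prod_apply_symm (measurable_proj hs),
    Measure.smul_apply, restrict_Omega', Measure.prod_apply_symm hs, smul_eq_mul,
    ← lintegral_const_mul' _ _ (by simp)]
  refine lintegral_mono fun φ => ?_
  exact strip_le φ (measurable_prodMk_right hs)

theorem quasi_proj : Measure.QuasiMeasurePreserving proj
    (((volume : Measure Plane).restrict Omega).prod
      ((volume : Measure ℝ).restrict (Set.Ico (-Real.pi) Real.pi)))
    ((volume : Measure (ℝ × ℝ)).restrict Omega') :=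
  ⟨measurable_proj, (Measure.absolutelyContinuous_of_le map_proj_le).trans
    (Measure.smul_absolutelyContinuous)⟩

theorem backprojectionFun_eq (g : ℝ × ℝ → ℝ) {x : Plane} (hx : x ∈ Omega) :
    backprojectionFun g x = ∫ φ in Set.Ico (-Real.pi) Real.pi, g (proj (x, φ)) := by
  refine setIntegral_congr_fun measurableSet_Ico fun φ hφ => ?_
  exact Set.indicator_of_mem (s := Omega') (f := g) ⟨inner_theta_mem hx φ, hφ⟩

theorem backprojectionFun_ae_eq (g : ℝ × ℝ → ℝ) :
    backprojectionFun g =ᵐ[(volume : Measure Plane).restrict Omega]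
      fun x => ∫ φ in Set.Ico (-Real.pi) Real.pi, g (proj (x, φ)) :=
  (ae_restrict_mem measurableSet_Omega).mono fun _ hx => backprojectionFun_eq g hx

theorem eLpNorm_comp_proj_le (g : L2Omega') :
    eLpNorm (fun z => g (proj z)) 2 (((volume : Measure Plane).restrict Omega).prod
      ((volume : Measure ℝ).restrict (Set.Ico (-Real.pi) Real.pi))) ≤
      2 ^ (1 / 2 : ℝ) * eLpNorm g 2 ((volume : Measure (ℝ × ℝ)).restrict Omega') := by
  have h1 := eLpNorm_mono_measure (p := 2) g map_proj_le
  rw [eLpNorm_map_measure ((Lp.aestronglyMeasurable g).mono_ac quasi_proj.absolutelyContinuous)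
    measurable_proj.aemeasurable,
    eLpNorm_smul_measure_of_ne_top (by simp)] at h1
  simpa [Function.comp_def] using h1

theorem memLp_comp_proj (g : L2Omega') :
    MemLp (fun z => g (proj z)) 2 (((volume : Measure Plane).restrict Omega).prod
      ((volume : Measure ℝ).restrict (Set.Ico (-Real.pi) Real.pi))) :=
  ⟨(Lp.aestronglyMeasurable g).comp_quasiMeasurePreserving quasi_proj,
    (eLpNorm_comp_proj_le g).trans_lt
      (ENNReal.mul_lt_top (ENNReal.rpow_lt_top_of_nonneg (by norm_num) (by simp))
        (Lp.memLp g).2)⟩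

theorem aesm_backprojectionFun (g : L2Omega') : AEStronglyMeasurable (backprojectionFun g)
    ((volume : Measure Plane).restrict Omega) :=
  (AEStronglyMeasurable.integral_prod_right' (memLp_comp_proj g).1).congr
    (backprojectionFun_ae_eq g).symm

theorem eLpNorm_backprojectionFun_le (g : L2Omega') :
    eLpNorm (backprojectionFun g) 2 ((volume : Measure Plane).restrict Omega) ≤
      (ENNReal.ofReal (2 * Real.pi)) ^ (1 / 2 : ℝ) * (2 ^ (1 / 2 : ℝ) *
        eLpNorm g 2 ((volume : Measure (ℝ × ℝ)).restrict Omega')) := by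
  refine le_trans ?_ (mul_le_mul_right (eLpNorm_comp_proj_le g) _)
  rw [eLpNorm_congr_ae (backprojectionFun_ae_eq g)]
  rw [eLpNorm_eq_lintegral_rpow_enorm_toReal (by simp) (by simp),
    eLpNorm_eq_lintegral_rpow_enorm_toReal (by simp) (by simp)]
  simp only [ENNReal.toReal_ofNat]
  rw [← ENNReal.mul_rpow_of_nonneg _ _ (by norm_num : (0 : ℝ) ≤ 1 / 2)]
  refine ENNReal.rpow_le_rpow ?_ (by norm_num)
  have hm : AEMeasurable (fun z => ‖g (proj z)‖ₑ ^ (2 : ℝ))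
      (((volume : Measure Plane).restrict Omega).prod
      ((volume : Measure ℝ).restrict (Set.Ico (-Real.pi) Real.pi))) :=
    (memLp_comp_proj g).1.enorm.pow_const _
  rw [lintegral_prod _ hm, ← lintegral_const_mul' _ _ ENNReal.ofReal_ne_top]
  refine lintegral_mono_ae ?_
  filter_upwards [(memLp_comp_proj g).1.prodMk_left] with x hx
  calc ‖∫ φ in Set.Ico (-Real.pi) Real.pi, g (proj (x, φ))‖ₑ ^ (2 : ℝ)
      ≤ (∫⁻ φ in Set.Ico (-Real.pi) Real.pi, ‖g (proj (x, φ))‖ₑ) ^ (2 : ℝ) :=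
        ENNReal.rpow_le_rpow (enorm_integral_le_lintegral_enorm _) (by norm_num)
    _ ≤ _ := by
        have h := eLpNorm_le_eLpNorm_mul_rpow_measure_univ (p := 1) (q := 2) (by norm_num) hx
        rw [eLpNorm_one_eq_lintegral_enorm,
          eLpNorm_eq_lintegral_rpow_enorm_toReal (by simp) (by simp)] at h
        refine (ENNReal.rpow_le_rpow h (by norm_num : (0 : ℝ) ≤ 2)).trans (le_of_eq ?_)
        rw [ENNReal.mul_rpow_of_nonneg _ _ (by norm_num), ← ENNReal.rpow_mul,
          ← ENNReal.rpow_mul, mul_comm]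
        congr 1
        · rw [Measure.restrict_apply_univ, Real.volume_Ico,
            show Real.pi - -Real.pi = 2 * Real.pi by ring]
          norm_num
        · norm_num

theorem memLp_backprojectionFun (g : L2Omega') :
    MemLp (backprojectionFun g) 2 ((volume : Measure Plane).restrict Omega) :=
  ⟨aesm_backprojectionFun g, (eLpNorm_backprojectionFun_le g).trans_lt
    (ENNReal.mul_lt_top const_ne_top.lt_top
      (ENNReal.mul_lt_top (ENNReal.rpow_lt_top_of_nonneg (by norm_num) (by simp))
        (Lp.memLp g).2))⟩

theorem ae_ae_of_ae_Omega' {p : ℝ × ℝ → Prop}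
    (h : ∀ᵐ y ∂((volume : Measure (ℝ × ℝ)).restrict Omega'), p y) :
    ∀ᵐ x ∂((volume : Measure Plane).restrict Omega),
      ∀ᵐ φ ∂((volume : Measure ℝ).restrict (Set.Ico (-Real.pi) Real.pi)), p (proj (x, φ)) :=
  Measure.ae_ae_of_ae_prod (quasi_proj.ae h)

theorem backprojectionFun_add (g h : L2Omega') :
    backprojectionFun (g + h : L2Omega') =ᵐ[(volume : Measure Plane).restrict Omega]
      backprojectionFun g + backprojectionFun h := by
  filter_upwards [backprojectionFun_ae_eq (g + h : L2Omega'), backprojectionFun_ae_eq g,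
    backprojectionFun_ae_eq h, ae_ae_of_ae_Omega' (Lp.coeFn_add g h),
    ((memLp_comp_proj g).integrable (by norm_num)).prod_right_ae,
    ((memLp_comp_proj h).integrable (by norm_num)).prod_right_ae] with x h1 h2 h3 h4 h5 h6
  rw [Pi.add_apply, h1, h2, h3, ← integral_add h5 h6]
  exact integral_congr_ae h4

theorem backprojectionFun_smul (c : ℝ) (g : L2Omega') :
    backprojectionFun (c • g : L2Omega') =ᵐ[(volume : Measure Plane).restrict Omega]
      c • backprojectionFun g := by
  filter_upwards [backprojectionFun_ae_eq (c • g : L2Omega'), backprojectionFun_ae_eq g,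
    ae_ae_of_ae_Omega' (Lp.coeFn_smul c g)] with x h1 h2 h3
  rw [Pi.smul_apply, h1, h2, smul_eq_mul, ← integral_const_mul]
  exact integral_congr_ae h3

/-- The backprojection `R* : L²(Ω') → L²(Ω)`. -/
def backprojection : L2Omega' →L[ℝ] L2Omega :=
  LinearMap.mkContinuous
    { toFun := fun g => (memLp_backprojectionFun g).toLp (backprojectionFun g)
      map_add' := fun g h => (MemLp.toLp_congr _
        ((memLp_backprojectionFun g).add (memLp_backprojectionFun h))
        (backprojectionFun_add g h)).trans (MemLp.toLp_add _ _)
      map_smul' := fun c g => (MemLp.toLp_congr _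
        ((memLp_backprojectionFun g).const_smul c)
        (backprojectionFun_smul c g)).trans (MemLp.toLp_const_smul _ _) }
    ((ENNReal.ofReal (2 * Real.pi)) ^ (1 / 2 : ℝ) * 2 ^ (1 / 2 : ℝ)).toReal
    (by
      intro g
      simp only [LinearMap.coe_mk, AddHom.coe_mk]
      rw [Lp.norm_toLp, Lp.norm_def, ← ENNReal.toReal_mul, mul_assoc]
      refine ENNReal.toReal_mono ?_ (eLpNorm_backprojectionFun_le g)
      exact ENNReal.mul_ne_top const_ne_top
        (ENNReal.mul_ne_top (ENNReal.rpow_ne_top_of_nonneg (by norm_num) (by simp))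
          (Lp.memLp g).2.ne))

/-! ### The discretization -/

/-- The hat function `w_δ(t) = max(0, δ - |t|)`. -/
def hat (δ t : ℝ) : ℝ := max 0 (δ - |t|)

/-- The data of a discretization: `P` detector offsets with spacing `δs`, angles
`φ 1 < ⋯ < φ Q` in `[-π, π[`, continued periodically by `φ 0` and `φ (Q + 1)` (the other values
of `φ` are irrelevant), and an `N × M` image grid with pixel size `δx`. -/
structure Grid where
  P : ℕ
  Q : ℕ
  N : ℕ
  M : ℕ
  δs : ℝ
  δx : ℝ
  φ : ℕ → ℝ
  δs_pos : 0 < δs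
  δx_pos : 0 < δx
  Q_pos : 1 ≤ Q
  φ_mem : ∀ q ∈ Finset.Icc 1 Q, φ q ∈ Set.Ico (-Real.pi) Real.pi
  φ_lt : ∀ q ∈ Finset.Icc 1 Q, ∀ q' ∈ Finset.Icc 1 Q, q < q' → φ q < φ q'
  φ_zero : φ 0 = φ Q - 2 * Real.pi
  φ_succ : φ (Q + 1) = φ 1 + 2 * Real.pi

namespace Grid

variable (D : Grid)

/-- The angular discretization width `max_q (φ_{q+1} - φ_q)`. -/
def δφ : ℝ :=
  (Finset.Icc 1 D.Q).sup' (Finset.nonempty_Icc.2 D.Q_pos) fun q => D.φ (q + 1) - D.φ q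

/-- The offset `s_p`. -/
def offset (p : ℕ) : ℝ := D.δs * ((p : ℝ) - ((D.P : ℝ) + 1) / 2)

/-- The offset interval `S_p`. -/
def offsetCell (p : ℕ) : Set ℝ :=
  Set.Ico (D.offset p - D.δs / 2) (D.offset p + D.δs / 2)

/-- The angular cell `Φ_q`, an interval taken modulo `2π`. -/
def angleCell (q : ℕ) : Set ℝ :=
  {φ | ∃ k : ℤ, φ + 2 * Real.pi * (k : ℝ) ∈
    Set.Ico ((D.φ (q - 1) + D.φ q) / 2) ((D.φ q + D.φ (q + 1)) / 2)}

/-- The pixel centre `x_{ij}`. -/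
def center (i j : ℕ) : Plane :=
  !₂[D.δx * ((i : ℝ) - ((D.N : ℝ) + 1) / 2), D.δx * ((j : ℝ) - ((D.M : ℝ) + 1) / 2)]

/-- The pixel `X_{ij}`. -/
def pixel (i j : ℕ) : Set Plane :=
  {x | ∀ k : Fin 2, x k - D.center i j k ∈ Set.Ico (-(D.δx / 2)) (D.δx / 2)}

/-- Compatibility with `Ω` and `Ω'`: the image pixels cover `Ω` and the sinogram pixels
`S_p × Φ_q` cover `Ω'`. -/
structure Compatible : Prop where
  image : Omega ⊆ ⋃ i ∈ Finset.Icc 1 D.N, ⋃ j ∈ Finset.Icc 1 D.M, D.pixel i j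
  sinogram : Omega' ⊆
    ⋃ p ∈ Finset.Icc 1 D.P, ⋃ q ∈ Finset.Icc 1 D.Q, D.offsetCell p ×ˢ D.angleCell q

/-- The pixel value `f_{ij}`: the mean over `X_{ij}` of `f`, extended by zero outside `Ω`. -/
def pixelMean (f : Plane → ℝ) (i j : ℕ) : ℝ :=
  1 / D.δx ^ 2 * ∫ x in D.pixel i j, Omega.indicator f x

/-- The fully discrete (pixel-driven) Radon transform of `f`, as a function of `(s, φ)`. -/
def discreteRadonFun (f : Plane → ℝ) (y : ℝ × ℝ) : ℝ :=
  D.δx ^ 2 / D.δs ^ 2 * ∑ p ∈ Finset.Icc 1 D.P, ∑ q ∈ Finset.Icc 1 D.Q,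
    (D.offsetCell p).indicator 1 y.1 * (D.angleCell q).indicator 1 y.2 *
      ∑ i ∈ Finset.Icc 1 D.N, ∑ j ∈ Finset.Icc 1 D.M,
        hat D.δs (inner ℝ (D.center i j) (theta (D.φ q)) - D.offset p) * D.pixelMean f i j

theorem measurableSet_pixel (i j : ℕ) : MeasurableSet (D.pixel i j) := by
  have : D.pixel i j = ⋂ k : Fin 2,
      (fun x : Plane => x k - D.center i j k) ⁻¹' Set.Ico (-(D.δx / 2)) (D.δx / 2) := by
    ext x; simp [pixel]
  rw [this]
  refine MeasurableSet.iInter fun k => ?_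
  have hc : Continuous fun x : Plane => x k - D.center i j k := by fun_prop
  exact hc.measurable measurableSet_Ico

theorem measurableSet_angleCell (q : ℕ) : MeasurableSet (D.angleCell q) := by
  have : D.angleCell q = ⋃ k : ℤ, (fun φ : ℝ => φ + 2 * Real.pi * (k : ℝ)) ⁻¹'
      Set.Ico ((D.φ (q - 1) + D.φ q) / 2) ((D.φ q + D.φ (q + 1)) / 2) := by
    ext φ; simp only [angleCell, Set.mem_ofPred_eq, Set.mem_iUnion, Set.mem_preimage]
  rw [this]
  exact MeasurableSet.iUnion fun k => (measurable_id.add_const _) measurableSet_Ico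

theorem pixelMean_eq (f : Plane → ℝ) (i j : ℕ) : D.pixelMean f i j =
    1 / D.δx ^ 2 * ∫ x in D.pixel i j, f x ∂((volume : Measure Plane).restrict Omega) := by
  rw [pixelMean, integral_indicator measurableSet_Omega,
    Measure.restrict_comm measurableSet_Omega]

/-- The pixel value as a continuous linear functional on `L²(Ω)`. -/
def pixelMeanCLM (i j : ℕ) : L2Omega →L[ℝ] ℝ :=
  (1 / D.δx ^ 2) • innerSL ℝ (indicatorConstLp 2 (D.measurableSet_pixel i j)
    (measure_ne_top ((volume : Measure Plane).restrict Omega) _) (1 : ℝ))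

theorem pixelMeanCLM_apply (f : L2Omega) (i j : ℕ) :
    D.pixelMeanCLM i j f = D.pixelMean f i j := by
  rw [pixelMean_eq]
  simp [pixelMeanCLM, L2.inner_indicatorConstLp_one]

theorem measurableSet_cell (p q : ℕ) : MeasurableSet (D.offsetCell p ×ˢ D.angleCell q) :=
  measurableSet_Ico.prod (D.measurableSet_angleCell q)

/-- The fully discrete (pixel-driven) Radon transform as an operator `L²(Ω) → L²(Ω')`, written
as a finite sum of rank-one operators; by `discreteRadon_ae_eq` it is `discreteRadonFun`. -/
def discreteRadon : L2Omega →L[ℝ] L2Omega' :=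
  (D.δx ^ 2 / D.δs ^ 2) • ∑ p ∈ Finset.Icc 1 D.P, ∑ q ∈ Finset.Icc 1 D.Q,
    (∑ i ∈ Finset.Icc 1 D.N, ∑ j ∈ Finset.Icc 1 D.M,
      hat D.δs (inner ℝ (D.center i j) (theta (D.φ q)) - D.offset p) •
        D.pixelMeanCLM i j).smulRight
      (indicatorConstLp 2 (D.measurableSet_cell p q)
        (measure_ne_top ((volume : Measure (ℝ × ℝ)).restrict Omega') _) (1 : ℝ))

theorem discreteRadon_ae_eq (f : L2Omega) :
    D.discreteRadon f =ᵐ[(volume : Measure (ℝ × ℝ)).restrict Omega'] D.discreteRadonFun f := by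
  have hcell : ∀ᵐ y ∂((volume : Measure (ℝ × ℝ)).restrict Omega'), ∀ p q : ℕ,
      indicatorConstLp 2 (D.measurableSet_cell p q)
        (measure_ne_top ((volume : Measure (ℝ × ℝ)).restrict Omega') _) (1 : ℝ) y =
      (D.offsetCell p).indicator 1 y.1 * (D.angleCell q).indicator 1 y.2 := by
    refine ae_all_iff.2 fun p => ae_all_iff.2 fun q => ?_
    filter_upwards [indicatorConstLp_coeFn (p := 2) (hs := D.measurableSet_cell p q)
      (hμs := measure_ne_top ((volume : Measure (ℝ × ℝ)).restrict Omega') _)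
      (c := (1 : ℝ))] with y hy
    rw [hy]
    by_cases h1 : y.1 ∈ D.offsetCell p <;> by_cases h2 : y.2 ∈ D.angleCell q <;>
      simp [Set.indicator, h1, h2]
  let a : ℕ → ℕ → ℝ := fun p q => ∑ i ∈ Finset.Icc 1 D.N, ∑ j ∈ Finset.Icc 1 D.M,
    hat D.δs (inner ℝ (D.center i j) (theta (D.φ q)) - D.offset p) * D.pixelMean f i j
  let e : ℕ → ℕ → L2Omega' := fun p q => indicatorConstLp 2 (D.measurableSet_cell p q)
    (measure_ne_top ((volume : Measure (ℝ × ℝ)).restrict Omega') _) (1 : ℝ)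
  have h0 : D.discreteRadon f = (D.δx ^ 2 / D.δs ^ 2) •
      ∑ p ∈ Finset.Icc 1 D.P, ∑ q ∈ Finset.Icc 1 D.Q, a p q • e p q := by
    simp [discreteRadon, a, e, pixelMeanCLM_apply]
  have hq : ∀ᵐ y ∂((volume : Measure (ℝ × ℝ)).restrict Omega'), ∀ p : ℕ,
      (∑ q ∈ Finset.Icc 1 D.Q, a p q • e p q : L2Omega') y =
        ∑ q ∈ Finset.Icc 1 D.Q, (a p q • e p q : L2Omega') y :=
    ae_all_iff.2 fun p => Lp.coeFn_fun_finsetSum _ _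
  have hs : ∀ᵐ y ∂((volume : Measure (ℝ × ℝ)).restrict Omega'), ∀ p q : ℕ,
      (a p q • e p q : L2Omega') y = a p q * e p q y :=
    ae_all_iff.2 fun p => ae_all_iff.2 fun q => Lp.coeFn_smul _ _
  rw [h0]
  filter_upwards [hcell, hq, hs, Lp.coeFn_smul (D.δx ^ 2 / D.δs ^ 2)
      (∑ p ∈ Finset.Icc 1 D.P, ∑ q ∈ Finset.Icc 1 D.Q, a p q • e p q),
    Lp.coeFn_fun_finsetSum (Finset.Icc 1 D.P)
      (fun p => ∑ q ∈ Finset.Icc 1 D.Q, a p q • e p q)] with y h1 h2 h3 h4 h5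
  rw [h4, Pi.smul_apply, h5, smul_eq_mul, discreteRadonFun]
  congr 1
  refine Finset.sum_congr rfl fun p _ => ?_
  rw [h2]
  refine Finset.sum_congr rfl fun q _ => ?_
  rw [h3, h1, mul_comm]

end Grid

theorem backprojection_ae_eq (g : L2Omega') :
    backprojection g =ᵐ[(volume : Measure Plane).restrict Omega] backprojectionFun g :=
  (memLp_backprojectionFun g).coeFn_toLp

end PixelRadon

end

noncomputable section

namespace PixelRadon

/-! ### The hat function -/

theorem hat_nonneg (δ t : ℝ) : 0 ≤ hat δ t := le_max_left _ _

theorem hat_le {δ : ℝ} (hδ : 0 ≤ δ) (t : ℝ) : hat δ t ≤ δ :=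
  max_le hδ (by linarith [abs_nonneg t])

theorem hat_eq_zero {δ t : ℝ} (h : δ ≤ |t|) : hat δ t = 0 := max_eq_left (by linarith)

theorem continuous_hat (δ : ℝ) : Continuous (hat δ) := by
  unfold hat; fun_prop

theorem abs_hat_sub_hat_le (δ t t' : ℝ) : |hat δ t - hat δ t'| ≤ |t - t'| := by
  refine (abs_max_sub_max_le_max _ _ _ _).trans ?_
  rw [sub_self, abs_zero, max_eq_right (abs_nonneg _),
    show δ - |t| - (δ - |t'|) = |t'| - |t| by ring, abs_sub_comm t t']
  exact abs_abs_sub_abs_le _ _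

theorem integral_hat {δ : ℝ} (hδ : 0 < δ) : ∫ t, hat δ t = δ ^ 2 := by
  have h0 : ∫ t, hat δ t = ∫ t in (-δ)..δ, hat δ t := by
    rw [intervalIntegral.integral_of_le (by linarith)]
    refine (setIntegral_eq_integral_of_forall_compl_eq_zero fun t ht => hat_eq_zero ?_).symm
    by_contra! h
    exact ht ⟨(abs_lt.1 h).1, (abs_lt.1 h).2.le⟩
  have hc : ∀ a b, IntervalIntegrable (hat δ) volume a b := fun a b =>
    (continuous_hat δ).intervalIntegrable a b
  have h1 : ∫ t in (-δ)..0, hat δ t = ∫ t in (-δ)..0, (δ + t) := by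
    refine intervalIntegral.integral_congr fun t ht => ?_
    rw [Set.uIcc_of_le (by linarith)] at ht
    simp only [hat]
    rw [abs_of_nonpos ht.2, max_eq_right (by linarith [ht.1])]; ring
  have h2 : ∫ t in (0 : ℝ)..δ, hat δ t = ∫ t in (0 : ℝ)..δ, (δ - t) := by
    refine intervalIntegral.integral_congr fun t ht => ?_
    rw [Set.uIcc_of_le (by linarith)] at ht
    simp only [hat]
    rw [abs_of_nonneg ht.1, max_eq_right (by linarith [ht.2])]
  rw [h0, ← intervalIntegral.integral_add_adjacent_intervals (hc _ 0) (hc _ _), h1, h2,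
    intervalIntegral.integral_add (by simp) (by simp),
    intervalIntegral.integral_sub (by simp) (by simp)]
  simp
  ring

theorem integrable_hat (δ : ℝ) : Integrable (hat δ) := by
  refine (continuous_hat δ).integrable_of_hasCompactSupport
    (HasCompactSupport.intro (isCompact_Icc (a := -δ) (b := δ)) fun t ht => hat_eq_zero ?_)
  by_contra! h
  exact ht ⟨(abs_lt.1 h).1.le, (abs_lt.1 h).2.le⟩

/-! ### Bounded integrable functions of one variable -/

/-- Measurable, bounded and integrable functions on the line. -/
structure BddIntegrable (g : ℝ → ℝ) : Prop where
  measurable : Measurable g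
  bounded : ∃ K, ∀ t, |g t| ≤ K
  integrable : Integrable g

namespace BddIntegrable

variable {g : ℝ → ℝ}

theorem integrable_sq (hg : BddIntegrable g) : Integrable fun t => g t ^ 2 := by
  obtain ⟨K, hK⟩ := hg.bounded
  simpa only [pow_two] using
    hg.integrable.bdd_mul hg.measurable.aestronglyMeasurable (ae_of_all _ hK)

theorem integrable_mul (hg : BddIntegrable g) {f : ℝ → ℝ} (hf : Integrable f) :
    Integrable fun t => g t * f t := by
  obtain ⟨K, hK⟩ := hg.bounded
  exact hf.bdd_mul hg.measurable.aestronglyMeasurable (ae_of_all _ hK)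

end BddIntegrable

/-- The window `[-r, r]`. -/
def window (r : ℝ) : ℝ → ℝ := (Set.Icc (-r) r).indicator 1

theorem window_nonneg (r t : ℝ) : 0 ≤ window r t :=
  Set.indicator_nonneg (fun _ _ => zero_le_one) _

theorem window_of_le {r t : ℝ} (h : |t| ≤ r) : window r t = 1 :=
  Set.indicator_of_mem (s := Set.Icc (-r) r) (abs_le.1 h) _

theorem window_of_lt {r t : ℝ} (h : r < |t|) : window r t = 0 :=
  Set.indicator_of_notMem (s := Set.Icc (-r) r) (fun h' => (abs_le.2 h').not_gt h) _

theorem measurable_window (r : ℝ) : Measurable (window r) :=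
  measurable_const.indicator measurableSet_Icc

theorem window_le_one (r t : ℝ) : window r t ≤ 1 :=
  Set.indicator_le' (fun _ _ => le_rfl) (fun _ _ => zero_le_one) t

theorem integrable_window (r : ℝ) : Integrable (window r) := by
  refine (integrable_indicator_iff measurableSet_Icc).2 ?_
  exact integrableOn_const (by simp)

theorem integral_window {r : ℝ} (hr : 0 ≤ r) : ∫ t, window r t = 2 * r := by
  rw [window, integral_indicator_one measurableSet_Icc]
  rw [Measure.real, Real.volume_Icc, ENNReal.toReal_ofReal (by linarith)]; ring

theorem window_sub_mul_integrable (r : ℝ) {f : ℝ → ℝ} (hf : Integrable f) (t : ℝ) :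
    Integrable fun s => window r (t - s) * f s := by
  refine hf.bdd_mul (c := 1) ((measurable_window r).comp (measurable_const.sub
    measurable_id)).aestronglyMeasurable (ae_of_all _ fun s => ?_)
  rw [Real.norm_eq_abs, abs_of_nonneg (window_nonneg _ _)]
  exact window_le_one _ _

theorem window_convolution_integrable (r : ℝ) {f : ℝ → ℝ} (hf : Integrable f) :
    Integrable (fun p : ℝ × ℝ => window r (p.1 - p.2) * f p.2) (volume.prod volume) := by
  have h := hf.convolution_integrand (ContinuousLinearMap.mul ℝ ℝ) (integrable_window r)
  simpa [mul_comm] using h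

theorem integral_window_convolution {r : ℝ} (hr : 0 ≤ r) {f : ℝ → ℝ} (hf : Integrable f) :
    ∫ t, ∫ s, window r (t - s) * f s = 2 * r * ∫ s, f s := by
  rw [integral_integral_swap (window_convolution_integrable r hf)]
  simp only [integral_mul_const]
  have : ∀ s, ∫ t, window r (t - s) = 2 * r := fun s => by
    rw [integral_sub_right_eq_self (window r) s, integral_window hr]
  simp only [this]
  rw [integral_const_mul]

/-- The mass of `g` in the interval of radius `r` around `t`. -/
def localMass (r : ℝ) (g : ℝ → ℝ) (t : ℝ) : ℝ := ∫ s, window r (t - s) * |g s|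

theorem abs_integral_le_localMass {r t : ℝ} {g k : ℝ → ℝ} (hg : Integrable g)
    (hk : ∀ s, |k s| ≤ window r (t - s)) : |∫ s, k s * g s| ≤ localMass r g t := by
  refine norm_integral_le_of_norm_le (f := fun s => k s * g s)
    (window_sub_mul_integrable r hg.abs t) (ae_of_all _ fun s => ?_)
  rw [norm_mul]
  exact mul_le_mul_of_nonneg_right (hk s) (abs_nonneg _)

namespace BddIntegrable

variable {g : ℝ → ℝ} {r : ℝ}

theorem localMass_sq_le (hg : BddIntegrable g) (hr : 0 < r) (t : ℝ) :
    localMass r g t ^ 2 ≤ 2 * r * ∫ s, window r (t - s) * g s ^ 2 := by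
  set L := localMass r g t with hL
  have i1 := window_sub_mul_integrable r hg.integrable_sq t
  have i2 := window_sub_mul_integrable r hg.integrable.abs t
  have i3 : Integrable fun s => window r (t - s) := (integrable_window r).comp_sub_left t
  have h : 0 ≤ ∫ s, window r (t - s) * (|g s| - L / (2 * r)) ^ 2 :=
    integral_nonneg fun _ => mul_nonneg (window_nonneg _ _) (sq_nonneg _)
  have e : ∀ s, window r (t - s) * (|g s| - L / (2 * r)) ^ 2 = window r (t - s) * g s ^ 2 -
      2 * (L / (2 * r)) * (window r (t - s) * |g s|) + (L / (2 * r)) ^ 2 * window r (t - s) := by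
    intro s
    rw [← sq_abs (g s)]; ring
  have hw : ∫ s, window r (t - s) = 2 * r := by
    rw [integral_sub_left_eq_self (window r) volume t, integral_window hr.le]
  simp only [e] at h
  rw [integral_add (f := fun s => _ - _) (i1.sub (i2.const_mul _)) (i3.const_mul _),
    integral_sub i1 (i2.const_mul _), integral_const_mul, integral_const_mul, hw] at h
  change 0 ≤ (∫ s, window r (t - s) * g s ^ 2) - 2 * (L / (2 * r)) * L + _ at h
  have h2 : 0 ≤ 2 * r * ((∫ s, window r (t - s) * g s ^ 2) - 2 * (L / (2 * r)) * L +
    (L / (2 * r)) ^ 2 * (2 * r)) := mul_nonneg (by linarith) h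
  have h3 : 2 * r * ((∫ s, window r (t - s) * g s ^ 2) - 2 * (L / (2 * r)) * L +
    (L / (2 * r)) ^ 2 * (2 * r)) = 2 * r * (∫ s, window r (t - s) * g s ^ 2) - L ^ 2 := by
    field_simp; ring
  linarith

theorem measurable_localMass (hg : BddIntegrable g) (r : ℝ) : Measurable (localMass r g) := by
  refine StronglyMeasurable.measurable ?_
  refine StronglyMeasurable.integral_prod_right (f := fun t s => window r (t - s) * |g s|) ?_
  refine Measurable.stronglyMeasurable ?_
  have := hg.measurable
  have := measurable_window r
  simp only [Function.uncurry_def]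
  fun_prop

theorem localMass_sq_integrable (hg : BddIntegrable g) (hr : 0 < r) :
    Integrable fun t => localMass r g t ^ 2 := by
  refine ((window_convolution_integrable r hg.integrable_sq).integral_prod_left.const_mul
    (2 * r)).mono' ((hg.measurable_localMass r).pow_const 2).aestronglyMeasurable
    (ae_of_all _ fun t => ?_)
  rw [Real.norm_eq_abs, abs_of_nonneg (sq_nonneg _)]
  exact hg.localMass_sq_le hr t

theorem integral_localMass_sq_le (hg : BddIntegrable g) (hr : 0 < r) :
    ∫ t, localMass r g t ^ 2 ≤ (2 * r) ^ 2 * ∫ t, g t ^ 2 := by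
  calc ∫ t, localMass r g t ^ 2 ≤ ∫ t, 2 * r * ∫ s, window r (t - s) * g s ^ 2 :=
        integral_mono (hg.localMass_sq_integrable hr)
          ((window_convolution_integrable r hg.integrable_sq).integral_prod_left.const_mul _)
          (hg.localMass_sq_le hr)
    _ = _ := by
        rw [integral_const_mul, integral_window_convolution hr.le hg.integrable_sq]; ring

/-- Integration by parts for a decaying function against a bounded integrable one. -/
theorem integral_mul_eq_neg (hg : BddIntegrable g) {Y Y' : ℝ → ℝ}
    (hY : ∀ u, HasDerivAt Y (Y' u) u) (hY' : Integrable Y') (hlim : Tendsto Y atTop (𝓝 0)) :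
    ∫ t, g t * Y t = -∫ u, (∫ t in Set.Iic u, g t) * Y' u := by
  have h1 : ∀ t, Y t = -∫ u, (Set.Ici t).indicator Y' u := by
    intro t
    rw [integral_indicator measurableSet_Ici, integral_Ici_eq_integral_Ioi,
      integral_Ioi_of_hasDerivAt_of_tendsto (hY t).continuousAt.continuousWithinAt
        (fun x _ => hY x) hY'.integrableOn hlim]
    ring
  have h2 : ∀ u, ∫ t in Set.Iic u, g t = ∫ t, (Set.Iic u).indicator g t := fun u =>
    (integral_indicator measurableSet_Iic).symm
  have e : ∀ t u, g t * (Set.Ici t).indicator Y' u = (Set.Iic u).indicator g t * Y' u := by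
    intro t u
    by_cases h : t ≤ u <;> simp [Set.indicator, h]
  have hint : Integrable (Function.uncurry fun t u => g t * (Set.Ici t).indicator Y' u)
      (volume.prod volume) := by
    have hm : MeasurableSet {p : ℝ × ℝ | p.1 ≤ p.2} := measurableSet_le measurable_fst measurable_snd
    refine ((hg.integrable.mul_prod hY').indicator hm).congr (ae_of_all _ fun p => ?_)
    by_cases h : p.1 ≤ p.2 <;> simp [Set.indicator, h, Function.uncurry]
  calc ∫ t, g t * Y t = -∫ t, ∫ u, g t * (Set.Ici t).indicator Y' u := by
        rw [← integral_neg]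
        refine integral_congr_ae (ae_of_all _ fun t => ?_)
        simp only
        rw [integral_const_mul, h1 t]; ring
    _ = _ := by
        rw [integral_integral_swap hint]
        simp only [e, integral_mul_const, h2]

end BddIntegrable

/-! ### Averaging with hat functions -/

/-- The average of `g` against hat functions of width `δ` centred at the points `c s`. -/
def smear (δ : ℝ) (c : ℝ → ℝ) (g : ℝ → ℝ) (t : ℝ) : ℝ := ∫ s, hat δ (t - c s) / δ ^ 2 * g s

/-- The deviation of `g` from its average. -/
def smearError (δ : ℝ) (c : ℝ → ℝ) (g : ℝ → ℝ) (t : ℝ) : ℝ := smear δ c g t - g t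

/-- The primitive of `g` vanishing at `-∞`. -/
def primitive (g : ℝ → ℝ) (u : ℝ) : ℝ := ∫ t in Set.Iic u, g t

section Smear

variable {δ : ℝ} {c g : ℝ → ℝ}

theorem hat_sub_center_le (hδ : 0 < δ) (hc : ∀ s, |c s - s| ≤ δ / 2) (t s : ℝ) :
    hat δ (t - c s) ≤ δ * window (3 / 2 * δ) (t - s) := by
  by_cases h : |t - s| ≤ 3 / 2 * δ
  · rw [window_of_le h, mul_one]; exact hat_le hδ.le _
  · rw [hat_eq_zero]
    · exact mul_nonneg hδ.le (window_nonneg _ _)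
    · have := abs_sub_le t (c s) s
      have := hc s
      linarith

theorem abs_smear_le (hδ : 0 < δ) (hc : ∀ s, |c s - s| ≤ δ / 2) (hg : BddIntegrable g) (t : ℝ) :
    |smear δ c g t| ≤ localMass (3 / 2 * δ) g t / δ := by
  have h := abs_integral_le_localMass (r := 3 / 2 * δ) (t := t) (g := g)
    (k := fun s => hat δ (t - c s) / δ) hg.integrable fun s => by
      rw [abs_of_nonneg (div_nonneg (hat_nonneg _ _) hδ.le), div_le_iff₀ hδ, mul_comm]
      exact hat_sub_center_le hδ hc t s
  have e : smear δ c g t = (∫ s, hat δ (t - c s) / δ * g s) / δ := by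
    rw [smear, ← integral_div]
    refine integral_congr_ae (ae_of_all _ fun s => ?_)
    simp only; field_simp
  rw [e, abs_div, abs_of_pos hδ]
  exact div_le_div_of_nonneg_right h hδ.le

theorem smear_integrand_integrable (hδ : 0 < δ) (hcm : Measurable c)
    (hc : ∀ s, |c s - s| ≤ δ / 2) (hg : Integrable g) (hgm : Measurable g) :
    Integrable (fun p : ℝ × ℝ => hat δ (p.1 - c p.2) / δ ^ 2 * g p.2) (volume.prod volume) := by
  refine ((window_convolution_integrable (3 / 2 * δ) hg.abs).div_const δ).mono' ?_
    (ae_of_all _ fun p => ?_)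
  · have := (continuous_hat δ).measurable
    exact Measurable.aestronglyMeasurable (by fun_prop)
  · rw [norm_mul, Real.norm_eq_abs, Real.norm_eq_abs,
      abs_of_nonneg (div_nonneg (hat_nonneg _ _) (sq_nonneg _)), mul_div_right_comm]
    refine mul_le_mul_of_nonneg_right ?_ (abs_nonneg _)
    rw [div_le_div_iff₀ (by positivity) hδ]
    nlinarith [hat_sub_center_le hδ hc p.1 p.2]

theorem measurable_smear (hcm : Measurable c) (hg : Measurable g) : Measurable (smear δ c g) := by
  refine StronglyMeasurable.measurable (StronglyMeasurable.integral_prod_right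
    (f := fun t s => hat δ (t - c s) / δ ^ 2 * g s) (Measurable.stronglyMeasurable ?_))
  have := (continuous_hat δ).measurable
  simp only [Function.uncurry_def]
  fun_prop

theorem localMass_le {r : ℝ} (hr : 0 < r) (hg : BddIntegrable g) {K : ℝ} (hK : ∀ t, |g t| ≤ K)
    (t : ℝ) : localMass r g t ≤ 2 * r * K := by
  have i3 : Integrable fun s => window r (t - s) := (integrable_window r).comp_sub_left t
  calc localMass r g t ≤ ∫ s, window r (t - s) * K :=
        integral_mono (window_sub_mul_integrable r hg.integrable.abs t) (i3.mul_const _)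
          fun s => mul_le_mul_of_nonneg_left (hK s) (window_nonneg _ _)
    _ = _ := by
        rw [integral_mul_const, integral_sub_left_eq_self (window r) volume t,
          integral_window hr.le]

theorem abs_smear_le_of_le (hδ : 0 < δ) (hc : ∀ s, |c s - s| ≤ δ / 2) (hg : BddIntegrable g)
    {K : ℝ} (hK : ∀ t, |g t| ≤ K) (t : ℝ) : |smear δ c g t| ≤ 3 * K := by
  refine (abs_smear_le hδ hc hg t).trans ?_
  rw [div_le_iff₀ hδ]
  have := localMass_le (by positivity : 0 < 3 / 2 * δ) hg hK t
  linarith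

theorem abs_smearError_le_of_le (hδ : 0 < δ) (hc : ∀ s, |c s - s| ≤ δ / 2)
    (hg : BddIntegrable g) {K : ℝ} (hK : ∀ t, |g t| ≤ K) (t : ℝ) :
    |smearError δ c g t| ≤ 4 * K := by
  have h1 := abs_smear_le_of_le hδ hc hg hK t
  have h2 := abs_sub (smear δ c g t) (g t)
  have h3 := hK t
  unfold smearError
  linarith

theorem BddIntegrable.smearError (hg : BddIntegrable g) (hδ : 0 < δ) (hcm : Measurable c)
    (hc : ∀ s, |c s - s| ≤ δ / 2) : BddIntegrable (smearError δ c g) := by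
  obtain ⟨K, hK⟩ := hg.bounded
  exact ⟨(measurable_smear hcm hg.measurable).sub hg.measurable,
    ⟨4 * K, abs_smearError_le_of_le hδ hc hg hK⟩,
    (smear_integrand_integrable hδ hcm hc hg.integrable hg.measurable).integral_prod_left.sub
      hg.integrable⟩

theorem integral_smearError_sq_le (hδ : 0 < δ) (hcm : Measurable c)
    (hc : ∀ s, |c s - s| ≤ δ / 2) (hg : BddIntegrable g) :
    ∫ t, smearError δ c g t ^ 2 ≤ 20 * ∫ t, g t ^ 2 := by
  have hr : 0 < 3 / 2 * δ := by positivity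
  have i1 := hg.localMass_sq_integrable hr
  calc ∫ t, smearError δ c g t ^ 2
      ≤ ∫ t, (2 / δ ^ 2 * localMass (3 / 2 * δ) g t ^ 2 + 2 * g t ^ 2) := by
        refine integral_mono (hg.smearError hδ hcm hc).integrable_sq
          ((i1.const_mul _).add (hg.integrable_sq.const_mul _)) fun t => ?_
        have h1 := sq_le_sq' (abs_le.1 (abs_smear_le hδ hc hg t)).1
          (abs_le.1 (abs_smear_le hδ hc hg t)).2
        rw [div_pow] at h1
        have h2 : 2 / δ ^ 2 * localMass (3 / 2 * δ) g t ^ 2 =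
          2 * (localMass (3 / 2 * δ) g t ^ 2 / δ ^ 2) := by ring
        simp only [PixelRadon.smearError]
        rw [h2]
        nlinarith [sq_nonneg (smear δ c g t + g t)]
    _ = 2 / δ ^ 2 * (∫ t, localMass (3 / 2 * δ) g t ^ 2) + 2 * ∫ t, g t ^ 2 := by
        rw [integral_add (i1.const_mul _) (hg.integrable_sq.const_mul _), integral_const_mul,
          integral_const_mul]
    _ ≤ 2 / δ ^ 2 * ((2 * (3 / 2 * δ)) ^ 2 * ∫ t, g t ^ 2) + 2 * ∫ t, g t ^ 2 := by
        gcongr; exact hg.integral_localMass_sq_le hr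
    _ = _ := by field_simp; ring

theorem integral_hat_Iic_sub_indicator (hδ : 0 < δ) (hc : ∀ s, |c s - s| ≤ δ / 2) (u s : ℝ) :
    |(∫ t in Set.Iic u, hat δ (t - c s) / δ ^ 2) - (Set.Iic u).indicator 1 s| ≤
      window (3 / 2 * δ) (u - s) := by
  have hi : Integrable fun t => hat δ (t - c s) / δ ^ 2 :=
    ((integrable_hat δ).comp_sub_right (c s)).div_const _
  have hn : ∀ t, 0 ≤ hat δ (t - c s) / δ ^ 2 := fun t => div_nonneg (hat_nonneg _ _) (sq_nonneg _)
  have htot : ∫ t, hat δ (t - c s) / δ ^ 2 = 1 := by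
    rw [integral_div, integral_sub_right_eq_self (hat δ), integral_hat hδ]
    exact div_self (by positivity)
  have h0 : 0 ≤ ∫ t in Set.Iic u, hat δ (t - c s) / δ ^ 2 := integral_nonneg hn
  have h1 : ∫ t in Set.Iic u, hat δ (t - c s) / δ ^ 2 ≤ 1 :=
    (setIntegral_le_integral hi (ae_of_all _ hn)).trans htot.le
  have hcs := abs_le.1 (hc s)
  by_cases h : |u - s| ≤ 3 / 2 * δ
  · rw [window_of_le h]
    by_cases hs : s ∈ Set.Iic u
    · rw [Set.indicator_of_mem hs, Pi.one_apply, abs_le]; constructor <;> linarith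
    · rw [Set.indicator_of_notMem hs, abs_le]; constructor <;> linarith
  · rw [window_of_lt (not_le.1 h)]
    rw [not_le] at h
    rcases lt_abs.1 h with h | h
    · rw [Set.indicator_of_mem (show s ∈ Set.Iic u by simp only [Set.mem_Iic]; linarith),
        setIntegral_eq_integral_of_forall_compl_eq_zero, htot]
      · simp
      · intro t ht
        rw [Set.mem_Iic, not_le] at ht
        rw [hat_eq_zero (by rw [le_abs]; left; linarith), zero_div]
    · rw [Set.indicator_of_notMem (show s ∉ Set.Iic u by simp only [Set.mem_Iic]; linarith),
        setIntegral_eq_zero_of_forall_eq_zero]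
      · simp
      · intro t ht
        rw [Set.mem_Iic] at ht
        rw [hat_eq_zero (by rw [le_abs]; right; linarith), zero_div]

theorem abs_primitive_smearError_le (hδ : 0 < δ) (hcm : Measurable c)
    (hc : ∀ s, |c s - s| ≤ δ / 2) (hg : BddIntegrable g) (u : ℝ) :
    |primitive (smearError δ c g) u| ≤ localMass (3 / 2 * δ) g u := by
  have hi := smear_integrand_integrable hδ hcm hc hg.integrable hg.measurable
  have hi' : Integrable (fun p : ℝ × ℝ => hat δ (p.1 - c p.2) / δ ^ 2 * g p.2)
      ((volume.restrict (Set.Iic u)).prod volume) :=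
    hi.mono_measure (Measure.prod_mono Measure.restrict_le_self le_rfl)
  have e1 : primitive (smearError δ c g) u =
      ∫ s, ((∫ t in Set.Iic u, hat δ (t - c s) / δ ^ 2) - (Set.Iic u).indicator 1 s) * g s := by
    unfold primitive smearError smear
    rw [integral_sub hi'.integral_prod_left hg.integrable.integrableOn,
      integral_integral_swap hi', ← integral_indicator measurableSet_Iic]
    rw [← integral_sub hi'.integral_prod_right (hg.integrable.indicator measurableSet_Iic)]
    refine integral_congr_ae (ae_of_all _ fun s => ?_)
    simp only [integral_mul_const, sub_mul]
    congr 1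
    by_cases hs : s ≤ u <;> simp [Set.indicator, hs]
  rw [e1]
  exact abs_integral_le_localMass hg.integrable (integral_hat_Iic_sub_indicator hδ hc u)

theorem measurable_primitive (hg : Measurable g) : Measurable (primitive g) := by
  have e : primitive g = fun u => ∫ t, (Set.Iic u).indicator g t :=
    funext fun u => (integral_indicator measurableSet_Iic).symm
  rw [e]
  refine StronglyMeasurable.measurable (StronglyMeasurable.integral_prod_right
    (f := fun u t => (Set.Iic u).indicator g t) (Measurable.stronglyMeasurable ?_))
  have hm : MeasurableSet {p : ℝ × ℝ | p.2 ≤ p.1} := measurableSet_le measurable_snd measurable_fst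
  exact (hg.comp measurable_snd).indicator hm

theorem primitive_smearError_sq_le (hδ : 0 < δ) (hcm : Measurable c)
    (hc : ∀ s, |c s - s| ≤ δ / 2) (hg : BddIntegrable g) :
    (Integrable fun u => primitive (smearError δ c g) u ^ 2) ∧
      ∫ u, primitive (smearError δ c g) u ^ 2 ≤ 9 * δ ^ 2 * ∫ t, g t ^ 2 := by
  have hr : 0 < 3 / 2 * δ := by positivity
  have hle : ∀ u, primitive (smearError δ c g) u ^ 2 ≤ localMass (3 / 2 * δ) g u ^ 2 := fun u =>
    sq_le_sq' (abs_le.1 (abs_primitive_smearError_le hδ hcm hc hg u)).1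
      (abs_le.1 (abs_primitive_smearError_le hδ hcm hc hg u)).2
  have i1 : Integrable fun u => primitive (smearError δ c g) u ^ 2 := by
    refine (hg.localMass_sq_integrable hr).mono' ((measurable_primitive
      (hg.smearError hδ hcm hc).measurable).pow_const 2).aestronglyMeasurable
      (ae_of_all _ fun u => ?_)
    rw [Real.norm_eq_abs, abs_of_nonneg (sq_nonneg _)]
    exact hle u
  refine ⟨i1, ((integral_mono i1 (hg.localMass_sq_integrable hr) hle).trans
    (hg.integral_localMass_sq_le hr)).trans (le_of_eq ?_)⟩
  ring

end Smear

/-! ### Rotated coordinates -/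

theorem measurePreserving_rotation (φ : ℝ) : MeasurePreserving
    (fun x : Plane => ((inner ℝ x (theta φ) : ℝ), (inner ℝ x (theta (φ + Real.pi / 2)) : ℝ)))
    volume (volume.prod volume) := by
  let A : Matrix (Fin 2) (Fin 2) ℝ :=
    !![Real.cos φ, Real.sin φ; -Real.sin φ, Real.cos φ]
  have hdet : A.det = 1 := by
    have h := Real.sin_sq_add_cos_sq φ
    simp only [A, Matrix.det_fin_two_of]
    linarith
  have hmap := Real.map_matrix_volume_pi_eq_smul_volume_pi (M := A) (by simp [hdet])
  rw [hdet] at hmap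
  simp only [inv_one, abs_one, ENNReal.ofReal_one, one_smul] at hmap
  have hmeas : Measurable (Matrix.toLin' A) :=
    (Matrix.toLin' A).continuous_of_finiteDimensional.measurable
  have hmp := (volume_preserving_finTwoArrow ℝ).comp (MeasurePreserving.comp
    (⟨hmeas, hmap⟩ : MeasurePreserving (Matrix.toLin' A) volume volume)
    (PiLp.volume_preserving_ofLp (Fin 2)))
  have e : (fun x : Plane => ((inner ℝ x (theta φ) : ℝ),
      (inner ℝ x (theta (φ + Real.pi / 2)) : ℝ))) =
      MeasurableEquiv.finTwoArrow ∘ Matrix.toLin' A ∘ WithLp.ofLp := by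
    funext x
    simp [inner_theta, A, MeasurableEquiv.finTwoArrow, Matrix.toLin'_apply, Matrix.mulVec,
      dotProduct, Fin.sum_univ_two, Real.cos_add_pi_div_two, Real.sin_add_pi_div_two]
  rw [e]
  exact hmp

theorem inner_theta_rotation (x : Plane) (φ ψ : ℝ) : inner ℝ x (theta ψ) =
    inner ℝ x (theta φ) * Real.cos (ψ - φ) +
      inner ℝ x (theta (φ + Real.pi / 2)) * Real.sin (ψ - φ) := by
  simp only [inner_theta, Real.cos_add_pi_div_two, Real.sin_add_pi_div_two, Real.cos_sub,
    Real.sin_sub]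
  have h := Real.sin_sq_add_cos_sq φ
  linear_combination (-(Real.cos ψ * x 0 + Real.sin ψ * x 1)) * h

theorem norm_sq_rotation (x : Plane) (φ : ℝ) : ‖x‖ ^ 2 =
    inner ℝ x (theta φ) ^ 2 + inner ℝ x (theta (φ + Real.pi / 2)) ^ 2 := by
  simp only [inner_theta, Real.cos_add_pi_div_two, Real.sin_add_pi_div_two,
    EuclideanSpace.norm_sq_eq, Fin.sum_univ_two, Real.norm_eq_abs, sq_abs]
  have h := Real.sin_sq_add_cos_sq φ
  linear_combination (-(x 0 ^ 2 + x 1 ^ 2)) * h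

theorem integral_rotation (φ : ℝ) {F : ℝ × ℝ → ℝ} (hF : Measurable F) :
    ∫ x : Plane, F (inner ℝ x (theta φ), inner ℝ x (theta (φ + Real.pi / 2))) =
      ∫ p, F p ∂(volume.prod volume) := by
  have h := measurePreserving_rotation φ
  rw [← h.map_eq, integral_map h.measurable.aemeasurable hF.aestronglyMeasurable]

theorem integrable_exp_neg_sq : Integrable fun w : ℝ => Real.exp (-w ^ 2) := by
  simpa using integrable_exp_neg_mul_sq one_pos

theorem integral_exp_neg_sq : ∫ w : ℝ, Real.exp (-w ^ 2) = √Real.pi := by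
  simpa using integral_gaussian 1

theorem exp_neg_sq_mul_integrable {f : ℝ → ℝ} (hf : Integrable f) :
    Integrable fun u => Real.exp (-u ^ 2) * f u := by
  refine hf.bdd_mul (c := 1) (by fun_prop) (ae_of_all _ fun u => ?_)
  rw [Real.norm_eq_abs, Real.abs_exp, Real.exp_le_one_iff]
  nlinarith

/-- The weighted `L²` pairing on the plane of two ridge functions. -/
def ridgePairing (h₁ h₂ : ℝ → ℝ) (φ ψ : ℝ) : ℝ :=
  ∫ x : Plane, Real.exp (-‖x‖ ^ 2) * (h₁ (inner ℝ x (theta φ)) * h₂ (inner ℝ x (theta ψ)))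

theorem integrable_exp_mul_ridge {f : ℝ → ℝ} (hf : Integrable f) (φ : ℝ) :
    Integrable fun x : Plane => Real.exp (-‖x‖ ^ 2) * f (inner ℝ x (theta φ)) := by
  have h := (measurePreserving_rotation φ).integrable_comp_of_integrable
    ((exp_neg_sq_mul_integrable hf).mul_prod integrable_exp_neg_sq)
  refine h.congr (ae_of_all _ fun x => ?_)
  simp only [Function.comp]
  rw [norm_sq_rotation x φ, neg_add, Real.exp_add]; ring

theorem integral_exp_mul_ridge_le {f : ℝ → ℝ} (hf : Integrable f) (hfm : Measurable f)
    (h0 : ∀ t, 0 ≤ f t) (φ : ℝ) :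
    ∫ x : Plane, Real.exp (-‖x‖ ^ 2) * f (inner ℝ x (theta φ)) ≤ √Real.pi * ∫ t, f t := by
  have e : ∫ x : Plane, Real.exp (-‖x‖ ^ 2) * f (inner ℝ x (theta φ)) =
      ∫ p : ℝ × ℝ, (Real.exp (-p.1 ^ 2) * f p.1) * Real.exp (-p.2 ^ 2)
        ∂(volume.prod volume) := by
    rw [← integral_rotation φ (by fun_prop)]
    refine integral_congr_ae (ae_of_all _ fun x => ?_)
    simp only
    rw [norm_sq_rotation x φ, neg_add, Real.exp_add]; ring
  rw [e, integral_prod_mul (fun u => Real.exp (-u ^ 2) * f u) fun w => Real.exp (-w ^ 2),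
    integral_exp_neg_sq, mul_comm]
  refine mul_le_mul_of_nonneg_left (integral_mono (exp_neg_sq_mul_integrable hf) hf fun u => ?_)
    (Real.sqrt_nonneg _)
  refine mul_le_of_le_one_left (h0 u) (Real.exp_le_one_iff.2 ?_)
  nlinarith

theorem abs_ridgePairing_le {h₁ h₂ : ℝ → ℝ} (hh₁ : BddIntegrable h₁) (hh₂ : BddIntegrable h₂)
    (φ ψ : ℝ) : |ridgePairing h₁ h₂ φ ψ| ≤
      √Real.pi / 2 * ((∫ t, h₁ t ^ 2) + ∫ t, h₂ t ^ 2) := by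
  have i1 := integrable_exp_mul_ridge hh₁.integrable_sq φ
  have i2 := integrable_exp_mul_ridge hh₂.integrable_sq ψ
  have b1 := integral_exp_mul_ridge_le hh₁.integrable_sq (hh₁.measurable.pow_const 2)
    (fun _ => sq_nonneg _) φ
  have b2 := integral_exp_mul_ridge_le hh₂.integrable_sq (hh₂.measurable.pow_const 2)
    (fun _ => sq_nonneg _) ψ
  have h : |ridgePairing h₁ h₂ φ ψ| ≤
      ∫ x : Plane, (Real.exp (-‖x‖ ^ 2) * h₁ (inner ℝ x (theta φ)) ^ 2 +
        Real.exp (-‖x‖ ^ 2) * h₂ (inner ℝ x (theta ψ)) ^ 2) / 2 := by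
    refine norm_integral_le_of_norm_le (f := fun x : Plane => Real.exp (-‖x‖ ^ 2) *
      (h₁ (inner ℝ x (theta φ)) * h₂ (inner ℝ x (theta ψ)))) ((i1.add i2).div_const 2)
      (ae_of_all _ fun x => ?_)
    rw [Real.norm_eq_abs, abs_mul, Real.abs_exp, abs_mul, ← mul_add, mul_div_assoc]
    refine mul_le_mul_of_nonneg_left ?_ (Real.exp_pos _).le
    have := two_mul_le_add_sq |h₁ (inner ℝ x (theta φ))| |h₂ (inner ℝ x (theta ψ))|
    rw [sq_abs, sq_abs] at this
    linarith
  rw [integral_div, integral_add i1 i2] at h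
  linarith

/-! ### Gaussians adapted to a pair of directions -/

/-- The form `u² + ((v - u c) / s)²`, that is `|x|²` in terms of the two projections
`u` and `v` of `x` to directions at an angle with cosine `c` and sine `s`. -/
def angleForm (c s u v : ℝ) : ℝ := u ^ 2 + ((v - u * c) / s) ^ 2

section AngleForm

variable {c s : ℝ}

theorem angleForm_comm (hs : s ≠ 0) (hcs : c ^ 2 + s ^ 2 = 1) (u v : ℝ) :
    angleForm c s u v = angleForm c s v u := by
  unfold angleForm
  field_simp
  linear_combination (u ^ 2 - v ^ 2) * hcs

theorem angleForm_nonneg (u v : ℝ) : 0 ≤ angleForm c s u v := by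
  unfold angleForm; positivity

theorem integrable_exp_angleForm (hs : s ≠ 0) (u : ℝ) :
    Integrable fun v => Real.exp (-(angleForm c s u v / 2)) := by
  have h := (((integrable_exp_neg_mul_sq (b := 1 / 2) (by norm_num)).comp_div hs).comp_sub_right
    (u * c)).const_mul (Real.exp (-(u ^ 2 / 2)))
  refine h.congr (ae_of_all _ fun v => ?_)
  simp only [angleForm]
  rw [← Real.exp_add]; congr 1; ring

theorem integral_exp_angleForm (u : ℝ) : ∫ v, Real.exp (-(angleForm c s u v / 2)) =
    √(2 * Real.pi) * |s| * Real.exp (-(u ^ 2 / 2)) := by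
  have e : ∀ v, Real.exp (-(angleForm c s u v / 2)) =
      Real.exp (-(u ^ 2 / 2)) * Real.exp (-(1 / 2) * ((v - u * c) / s) ^ 2) := by
    intro v
    simp only [angleForm]
    rw [← Real.exp_add]; congr 1; ring
  simp only [e]
  rw [integral_const_mul, integral_sub_right_eq_self
    (fun v => Real.exp (-(1 / 2) * (v / s) ^ 2)) (u * c),
    Measure.integral_comp_div (fun y => Real.exp (-(1 / 2) * y ^ 2)) s, integral_gaussian,
    smul_eq_mul, show Real.pi / (1 / 2) = 2 * Real.pi by ring]
  ring

theorem measurable_exp_angleForm :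
    Measurable fun p : ℝ × ℝ => Real.exp (-(angleForm c s p.1 p.2 / 2)) := by
  unfold angleForm; fun_prop

theorem integrable_mul_exp_angleForm (hs : s ≠ 0) {f : ℝ → ℝ} (hf : Integrable f)
    (hfm : Measurable f) : Integrable
      (fun p : ℝ × ℝ => f p.1 * Real.exp (-(angleForm c s p.1 p.2 / 2)))
      (volume.prod volume) := by
  have hm : Measurable fun p : ℝ × ℝ => f p.1 * Real.exp (-(angleForm c s p.1 p.2 / 2)) :=
    (hfm.comp measurable_fst).mul measurable_exp_angleForm
  refine (integrable_prod_iff hm.aestronglyMeasurable).2 ⟨ae_of_all _ fun u =>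
      (integrable_exp_angleForm hs u).const_mul (f u), ?_⟩
  have e : ∀ u, ∫ v, ‖f u * Real.exp (-(angleForm c s u v / 2))‖ =
      (√(2 * Real.pi) * |s|) * (Real.exp (-(u ^ 2 / 2)) * |f u|) := by
    intro u
    simp only [norm_mul, Real.norm_eq_abs, Real.abs_exp]
    rw [integral_const_mul, integral_exp_angleForm]; ring
  simp only [e]
  refine Integrable.const_mul (hf.abs.bdd_mul (c := 1) (by fun_prop)
    (ae_of_all _ fun u => ?_)) _
  rw [Real.norm_eq_abs, Real.abs_exp, Real.exp_le_one_iff]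
  nlinarith

theorem integral_mul_exp_angleForm_le (hs : s ≠ 0) {f : ℝ → ℝ} (hf : Integrable f)
    (hfm : Measurable f) (h0 : ∀ t, 0 ≤ f t) :
    ∫ p : ℝ × ℝ, f p.1 * Real.exp (-(angleForm c s p.1 p.2 / 2)) ∂(volume.prod volume) ≤
      √(2 * Real.pi) * |s| * ∫ t, f t := by
  rw [integral_prod _ (integrable_mul_exp_angleForm hs hf hfm)]
  simp only [integral_const_mul, integral_exp_angleForm]
  rw [← integral_const_mul]
  refine integral_mono_of_nonneg (ae_of_all _ fun u => ?_) (hf.const_mul _)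
    (ae_of_all _ fun u => ?_)
  · exact mul_nonneg (h0 u) (by positivity)
  · simp only
    rw [mul_comm (f u)]
    refine mul_le_mul_of_nonneg_right (mul_le_of_le_one_right (by positivity)
      (Real.exp_le_one_iff.2 ?_)) (h0 u)
    nlinarith

/-- The partial derivative of `exp (-angleForm)` in its second variable. -/
def angleDeriv (c s u v : ℝ) : ℝ :=
  -(2 / s) * ((v - u * c) / s) * Real.exp (-angleForm c s u v)

/-- The mixed second derivative of `exp (-angleForm)`. -/
def angleDeriv₂ (c s u v : ℝ) : ℝ :=
  (2 * c / s ^ 2 + 4 / s ^ 2 * (((v - u * c) / s) * ((u - v * c) / s))) *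
    Real.exp (-angleForm c s u v)

theorem hasDerivAt_exp_angleForm (u v : ℝ) :
    HasDerivAt (fun v => Real.exp (-angleForm c s u v)) (angleDeriv c s u v) v := by
  have h : HasDerivAt (fun v => -angleForm c s u v) (-(2 / s) * ((v - u * c) / s)) v := by
    unfold angleForm
    have h1 := (((((hasDerivAt_id v).sub_const (u * c)).div_const s).pow 2).const_add
      (u ^ 2)).neg
    refine h1.congr_deriv ?_
    simp only [id]
    push_cast
    ring
  have h2 := h.exp
  rwa [mul_comm] at h2

theorem hasDerivAt_angleDeriv (hs : s ≠ 0) (hcs : c ^ 2 + s ^ 2 = 1) (u v : ℝ) :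
    HasDerivAt (fun u => angleDeriv c s u v) (angleDeriv₂ c s u v) u := by
  have h : HasDerivAt (fun u => Real.exp (-angleForm c s u v)) (angleDeriv c s v u) u := by
    simpa only [angleForm_comm hs hcs _ v] using hasDerivAt_exp_angleForm (c := c) (s := s) v u
  have h1 : HasDerivAt (fun u => -(2 / s) * ((v - u * c) / s)) (2 * c / s ^ 2) u := by
    have := ((((hasDerivAt_id u).mul_const c).const_sub v).div_const s).const_mul (-(2 / s))
    refine this.congr_deriv ?_
    field_simp
  have h2 := h1.mul h
  refine h2.congr_deriv ?_
  unfold angleDeriv angleDeriv₂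
  rw [angleForm_comm hs hcs v u]
  ring

theorem abs_angleDeriv_le (u v : ℝ) :
    |angleDeriv c s u v| ≤ 2 / |s| * Real.exp (-(angleForm c s u v / 2)) := by
  set q := angleForm c s u v with hq
  set y := (v - u * c) / s with hy
  have hyq : y ^ 2 ≤ q := by
    rw [hq, angleForm, ← hy]; nlinarith [sq_nonneg u]
  have hy1 : |y| ≤ Real.exp (q / 2) := by
    have h1 := Real.add_one_le_exp (q / 2)
    nlinarith [sq_abs y, sq_nonneg (|y| - 1)]
  rw [angleDeriv, ← hq, ← hy, abs_mul, abs_mul, Real.abs_exp, abs_neg, abs_div, abs_two, mul_assoc]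
  refine mul_le_mul_of_nonneg_left ?_ (by positivity)
  calc |y| * Real.exp (-q) ≤ Real.exp (q / 2) * Real.exp (-q) := by gcongr
    _ = _ := by rw [← Real.exp_add]; congr 1; ring

theorem abs_angleDeriv₂_le (hs : s ≠ 0) (hcs : c ^ 2 + s ^ 2 = 1) (u v : ℝ) :
    |angleDeriv₂ c s u v| ≤ 8 / s ^ 2 * Real.exp (-(angleForm c s u v / 2)) := by
  have hq2 := angleForm_comm hs hcs u v
  set q := angleForm c s u v with hq
  set y := (v - u * c) / s with hy
  set z := (u - v * c) / s with hz
  have hyq : y ^ 2 ≤ q := by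
    rw [hq, angleForm, ← hy]; nlinarith [sq_nonneg u]
  have hzq : z ^ 2 ≤ q := by
    rw [hq2, angleForm, ← hz]; nlinarith [sq_nonneg v]
  have hc : |c| ≤ 1 := (sq_le_one_iff_abs_le_one c).1 (by nlinarith [sq_nonneg s])
  have hyz : |y * z| ≤ q := by
    rw [abs_le]; constructor <;> nlinarith [sq_nonneg (y - z), sq_nonneg (y + z)]
  have h1 : |2 * c + 4 * (y * z)| ≤ 8 * Real.exp (q / 2) := by
    have h1 := Real.add_one_le_exp (q / 2)
    have h2 := abs_le.1 hc
    have h3 := abs_le.1 hyz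
    rw [abs_le]; constructor <;> linarith
  rw [angleDeriv₂, ← hq, ← hy, ← hz, show 2 * c / s ^ 2 + 4 / s ^ 2 * (y * z) =
    (2 * c + 4 * (y * z)) / s ^ 2 by ring, abs_mul, Real.abs_exp, abs_div,
    abs_of_nonneg (sq_nonneg s)]
  calc |2 * c + 4 * (y * z)| / s ^ 2 * Real.exp (-q)
      ≤ 8 * Real.exp (q / 2) / s ^ 2 * Real.exp (-q) := by gcongr
    _ = 8 / s ^ 2 * (Real.exp (q / 2) * Real.exp (-q)) := by ring
    _ = _ := by rw [← Real.exp_add]; congr 3; ring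

theorem measurable_angleDeriv : Measurable fun p : ℝ × ℝ => angleDeriv c s p.1 p.2 := by
  unfold angleDeriv angleForm; fun_prop

theorem measurable_angleDeriv₂ : Measurable fun p : ℝ × ℝ => angleDeriv₂ c s p.1 p.2 := by
  unfold angleDeriv₂ angleForm; fun_prop

theorem tendsto_exp_angleForm (hs : s ≠ 0) (u : ℝ) :
    Tendsto (fun v => Real.exp (-(angleForm c s u v / 2))) atTop (𝓝 0) := by
  refine Real.tendsto_exp_neg_atTop_nhds_zero.comp ?_
  have h1 : Tendsto (fun v : ℝ => v - u * c) atTop atTop :=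
    tendsto_atTop_add_const_right _ _ tendsto_id
  have h2 : Tendsto (fun v : ℝ => (v - u * c) ^ 2) atTop atTop :=
    (tendsto_pow_atTop two_ne_zero).comp h1
  have h3 : Tendsto (fun v : ℝ => u ^ 2 / 2 + (v - u * c) ^ 2 * (1 / (2 * s ^ 2))) atTop atTop :=
    tendsto_atTop_add_const_left _ _ (h2.atTop_mul_const (by positivity))
  refine h3.congr fun v => ?_
  unfold angleForm
  field_simp

theorem abs_primitive_le {h : ℝ → ℝ} (hh : Integrable h) (u : ℝ) :
    |primitive h u| ≤ ∫ t, |h t| :=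
  (abs_integral_le_integral_abs).trans
    (setIntegral_le_integral hh.abs (ae_of_all _ fun _ => abs_nonneg _))

theorem sq_mul_abs_integral_angle_le (hs : s ≠ 0) (hcs : c ^ 2 + s ^ 2 = 1) {h₁ h₂ : ℝ → ℝ}
    (hh₁ : BddIntegrable h₁) (hh₂ : BddIntegrable h₂)
    (i₁ : Integrable fun u => primitive h₁ u ^ 2) (i₂ : Integrable fun u => primitive h₂ u ^ 2) :
    |s| * |∫ u, h₁ u * ∫ v, h₂ v * Real.exp (-angleForm c s u v)| ≤
      4 * √(2 * Real.pi) * ((∫ u, primitive h₁ u ^ 2) + ∫ u, primitive h₂ u ^ 2) := by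
  have mp₁ := measurable_primitive hh₁.measurable
  have mp₂ := measurable_primitive hh₂.measurable
  have ibp₁ : ∀ u, ∫ v, h₂ v * Real.exp (-angleForm c s u v) =
      -∫ v, primitive h₂ v * angleDeriv c s u v := by
    intro u
    refine hh₂.integral_mul_eq_neg (fun v => hasDerivAt_exp_angleForm u v) ?_ ?_
    · exact ((integrable_exp_angleForm hs u).const_mul (2 / |s|)).mono'
        (measurable_angleDeriv.comp measurable_prodMk_left).aestronglyMeasurable
        (ae_of_all _ fun v => abs_angleDeriv_le u v)
    · refine squeeze_zero (fun v => (Real.exp_pos _).le) (fun v => ?_)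
        (tendsto_exp_angleForm (c := c) hs u)
      exact Real.exp_le_exp.2 (by linarith [angleForm_nonneg (c := c) (s := s) u v])
  have ibp₂ : ∀ v, ∫ u, h₁ u * angleDeriv c s u v =
      -∫ u, primitive h₁ u * angleDeriv₂ c s u v := by
    intro v
    refine hh₁.integral_mul_eq_neg (fun u => hasDerivAt_angleDeriv hs hcs u v) ?_ ?_
    · refine ((integrable_exp_angleForm (c := c) hs v).const_mul (8 / s ^ 2)).mono'
        (measurable_angleDeriv₂.comp measurable_prodMk_right).aestronglyMeasurable
        (ae_of_all _ fun u => ?_)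
      rw [angleForm_comm hs hcs]
      exact abs_angleDeriv₂_le hs hcs u v
    · refine squeeze_zero_norm (a := fun u => 2 / |s| * Real.exp (-(angleForm c s v u / 2)))
        (fun u => ?_) ?_
      · rw [angleForm_comm hs hcs]; exact abs_angleDeriv_le u v
      · simpa using (tendsto_exp_angleForm (c := c) hs v).const_mul (2 / |s|)
  have hint : Integrable (Function.uncurry fun u v => h₁ u * (primitive h₂ v * angleDeriv c s u v))
      (volume.prod volume) := by
    refine ((integrable_mul_exp_angleForm (c := c) hs hh₁.integrable.abs
      hh₁.measurable.abs).const_mul ((∫ t, |h₂ t|) * (2 / |s|))).mono' ?_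
      (ae_of_all _ fun p => ?_)
    · have := measurable_angleDeriv (c := c) (s := s)
      have := hh₁.measurable
      refine Measurable.aestronglyMeasurable ?_
      simp only [Function.uncurry_def]
      fun_prop
    · simp only [Function.uncurry_def]
      rw [norm_mul, norm_mul, Real.norm_eq_abs, Real.norm_eq_abs, Real.norm_eq_abs]
      calc _ ≤ |h₁ p.1| * ((∫ t, |h₂ t|) * (2 / |s| * Real.exp (-(angleForm c s p.1 p.2 / 2)))) := by
            refine mul_le_mul_of_nonneg_left (mul_le_mul (abs_primitive_le hh₂.integrable _)
              (abs_angleDeriv_le _ _) (abs_nonneg _) (integral_nonneg fun _ => abs_nonneg _))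
              (abs_nonneg _)
        _ = _ := by ring
  have e : ∫ u, h₁ u * ∫ v, h₂ v * Real.exp (-angleForm c s u v) =
      ∫ v, ∫ u, primitive h₂ v * primitive h₁ u * angleDeriv₂ c s u v := by
    simp only [ibp₁]
    calc ∫ u, h₁ u * -∫ v, primitive h₂ v * angleDeriv c s u v
        = -∫ u, ∫ v, h₁ u * (primitive h₂ v * angleDeriv c s u v) := by
          simp only [mul_neg, integral_neg, integral_const_mul]
      _ = -∫ v, primitive h₂ v * ∫ u, h₁ u * angleDeriv c s u v := by
          rw [integral_integral_swap hint]
          congr 1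
          refine integral_congr_ae (ae_of_all _ fun v => ?_)
          simp only
          rw [← integral_const_mul]
          refine integral_congr_ae (ae_of_all _ fun u => ?_)
          simp only; ring
      _ = _ := by
          simp only [ibp₂, mul_neg, integral_neg, neg_neg]
          refine integral_congr_ae (ae_of_all _ fun v => ?_)
          simp only
          rw [← integral_const_mul]
          refine integral_congr_ae (ae_of_all _ fun u => ?_)
          simp only; ring
  have j₂ := integrable_mul_exp_angleForm (c := c) hs i₂ (mp₂.pow_const 2)
  have j₁' := (integrable_mul_exp_angleForm (c := c) hs i₁ (mp₁.pow_const 2)).swap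
  have j₁ : Integrable (fun p : ℝ × ℝ => primitive h₁ p.2 ^ 2 *
      Real.exp (-(angleForm c s p.1 p.2 / 2))) (volume.prod volume) := by
    refine j₁'.congr (ae_of_all _ fun p => ?_)
    simp only [Function.comp, Prod.fst_swap, Prod.snd_swap]
    rw [angleForm_comm hs hcs]
  have b₂ := integral_mul_exp_angleForm_le (c := c) hs i₂ (mp₂.pow_const 2) fun _ => sq_nonneg _
  have b₁ : ∫ p : ℝ × ℝ, primitive h₁ p.2 ^ 2 *
      Real.exp (-(angleForm c s p.1 p.2 / 2)) ∂(volume.prod volume) ≤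
      √(2 * Real.pi) * |s| * ∫ t, primitive h₁ t ^ 2 := by
    refine le_trans (le_of_eq ?_) (integral_mul_exp_angleForm_le (c := c) hs i₁
      (mp₁.pow_const 2) fun _ => sq_nonneg _)
    rw [← integral_prod_swap]
    refine integral_congr_ae (ae_of_all _ fun p => ?_)
    simp only [Prod.fst_swap, Prod.snd_swap]
    rw [angleForm_comm hs hcs]
  have hb : ∀ p : ℝ × ℝ, ‖primitive h₂ p.1 * primitive h₁ p.2 * angleDeriv₂ c s p.2 p.1‖ ≤
      4 / s ^ 2 * (primitive h₂ p.1 ^ 2 * Real.exp (-(angleForm c s p.1 p.2 / 2)) +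
        primitive h₁ p.2 ^ 2 * Real.exp (-(angleForm c s p.1 p.2 / 2))) := by
    intro p
    have h1 := abs_angleDeriv₂_le hs hcs p.2 p.1
    rw [angleForm_comm hs hcs] at h1
    have h2 := two_mul_le_add_sq |primitive h₂ p.1| |primitive h₁ p.2|
    rw [sq_abs, sq_abs] at h2
    rw [norm_mul, norm_mul, Real.norm_eq_abs, Real.norm_eq_abs, Real.norm_eq_abs]
    calc _ ≤ (primitive h₂ p.1 ^ 2 + primitive h₁ p.2 ^ 2) / 2 *
          (8 / s ^ 2 * Real.exp (-(angleForm c s p.1 p.2 / 2))) :=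
          mul_le_mul (by linarith) h1 (abs_nonneg _) (by positivity)
      _ = _ := by ring
  have hm : Measurable fun p : ℝ × ℝ =>
      primitive h₂ p.1 * primitive h₁ p.2 * angleDeriv₂ c s p.2 p.1 := by
    have := measurable_angleDeriv₂ (c := c) (s := s)
    have h := this.comp measurable_swap
    exact ((mp₂.comp measurable_fst).mul (mp₁.comp measurable_snd)).mul h
  have hdom : Integrable (fun p : ℝ × ℝ => 4 / s ^ 2 * (primitive h₂ p.1 ^ 2 *
      Real.exp (-(angleForm c s p.1 p.2 / 2)) + primitive h₁ p.2 ^ 2 *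
        Real.exp (-(angleForm c s p.1 p.2 / 2)))) (volume.prod volume) := (j₂.add j₁).const_mul _
  have hfin := norm_integral_le_of_norm_le hdom (ae_of_all _ hb)
  rw [integral_prod _ (hdom.mono' hm.aestronglyMeasurable (ae_of_all _ hb)), integral_const_mul,
    integral_add j₂ j₁] at hfin
  rw [e]
  have hs' : 0 < |s| := abs_pos.2 hs
  calc _ ≤ |s| * (4 / s ^ 2 * (√(2 * Real.pi) * |s| * (∫ t, primitive h₂ t ^ 2) +
          √(2 * Real.pi) * |s| * ∫ t, primitive h₁ t ^ 2)) := by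
        refine mul_le_mul_of_nonneg_left (hfin.trans ?_) hs'.le
        exact mul_le_mul_of_nonneg_left (add_le_add b₂ b₁) (by positivity)
    _ = _ := by
        rw [← sq_abs s]; field_simp; ring

end AngleForm

theorem ridgePairing_eq {h₁ h₂ : ℝ → ℝ} (hh₁ : BddIntegrable h₁) (hh₂ : BddIntegrable h₂)
    {φ ψ : ℝ} (hs : Real.sin (ψ - φ) ≠ 0) :
    ridgePairing h₁ h₂ φ ψ = |Real.sin (ψ - φ)|⁻¹ * ∫ u, h₁ u * ∫ v, h₂ v *
      Real.exp (-angleForm (Real.cos (ψ - φ)) (Real.sin (ψ - φ)) u v) := by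
  set c := Real.cos (ψ - φ)
  set s := Real.sin (ψ - φ) with hs_def
  have m₁ := hh₁.measurable
  have m₂ := hh₂.measurable
  let F : ℝ × ℝ → ℝ := fun p =>
    Real.exp (-(p.1 ^ 2 + p.2 ^ 2)) * (h₁ p.1 * h₂ (p.1 * c + p.2 * s))
  have hF : Measurable F := by fun_prop
  have hFi : Integrable F (volume.prod volume) := by
    obtain ⟨K, hK⟩ := hh₁.bounded
    obtain ⟨L, hL⟩ := hh₂.bounded
    have hG : Integrable (fun p : ℝ × ℝ => Real.exp (-(p.1 ^ 2 + p.2 ^ 2)))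
        (volume.prod volume) := by
      refine (integrable_exp_neg_sq.mul_prod integrable_exp_neg_sq).congr (ae_of_all _ fun p => ?_)
      simp only
      rw [← Real.exp_add]; congr 1; ring
    refine hG.mul_bdd (c := K * L) (Measurable.aestronglyMeasurable (by fun_prop))
      (ae_of_all _ fun p => ?_)
    rw [norm_mul]
    exact mul_le_mul (hK _) (hL _) (norm_nonneg _) ((abs_nonneg _).trans (hK 0))
  have e1 : ridgePairing h₁ h₂ φ ψ = ∫ p, F p ∂(volume.prod volume) := by
    rw [← integral_rotation φ hF]
    refine integral_congr_ae (ae_of_all _ fun x => ?_)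
    simp only [F]
    rw [norm_sq_rotation x φ, inner_theta_rotation x φ ψ]
  rw [e1, integral_prod _ hFi, ← integral_const_mul]
  refine integral_congr_ae (ae_of_all _ fun u => ?_)
  simp only [F]
  have e2 : ∀ w, Real.exp (-(u ^ 2 + w ^ 2)) * (h₁ u * h₂ (u * c + w * s)) =
      h₁ u * (fun v => h₂ (v + u * c) * Real.exp (-angleForm c s u (v + u * c))) (w * s) := by
    intro w
    simp only [angleForm, add_sub_cancel_right]
    rw [mul_div_assoc, div_self hs, mul_one, add_comm (u * c)]
    ring
  simp only [e2]
  rw [integral_const_mul, Measure.integral_comp_mul_right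
    (fun v => h₂ (v + u * c) * Real.exp (-angleForm c s u (v + u * c))) s,
    integral_add_right_eq_self (fun v => h₂ v * Real.exp (-angleForm c s u v)) (u * c),
    smul_eq_mul, abs_inv]
  ring

theorem sin_sq_mul_abs_ridgePairing_le {h₁ h₂ : ℝ → ℝ} (hh₁ : BddIntegrable h₁)
    (hh₂ : BddIntegrable h₂) (i₁ : Integrable fun u => primitive h₁ u ^ 2)
    (i₂ : Integrable fun u => primitive h₂ u ^ 2) (φ ψ : ℝ) :
    Real.sin (ψ - φ) ^ 2 * |ridgePairing h₁ h₂ φ ψ| ≤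
      4 * √(2 * Real.pi) * ((∫ u, primitive h₁ u ^ 2) + ∫ u, primitive h₂ u ^ 2) := by
  by_cases hs : Real.sin (ψ - φ) = 0
  · rw [hs]
    have h1 : 0 ≤ ∫ u, primitive h₁ u ^ 2 := integral_nonneg fun _ => sq_nonneg _
    have h2 : 0 ≤ ∫ u, primitive h₂ u ^ 2 := integral_nonneg fun _ => sq_nonneg _
    simp only [ne_eq, OfNat.ofNat_ne_zero, not_false_eq_true, zero_pow, zero_mul]
    positivity
  · rw [ridgePairing_eq hh₁ hh₂ hs]
    refine le_trans (le_of_eq ?_) (sq_mul_abs_integral_angle_le hs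
      (Real.cos_sq_add_sin_sq (ψ - φ)) hh₁ hh₂ i₁ i₂)
    have := abs_pos.2 hs
    rw [abs_mul, abs_inv, abs_abs, ← sq_abs (Real.sin _)]
    field_simp

/-! ### Square mean of the backprojected deviation -/

/-- The measure on the angles. -/
abbrev angleMeasure : Measure ℝ := volume.restrict (Set.Ico (-Real.pi) Real.pi)

/-- Bounded measurable functions vanishing outside `Ω'`. -/
structure BddSinogram (g : ℝ × ℝ → ℝ) : Prop where
  measurable : Measurable g
  bounded : ∃ K, ∀ y, |g y| ≤ K
  support : ∀ y ∉ Omega', g y = 0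

/-- The angular weight `δ² / (δ² + sin² α)`. -/
def angleWeight (δ α : ℝ) : ℝ := δ ^ 2 / (δ ^ 2 + Real.sin α ^ 2)

theorem angleWeight_nonneg (δ α : ℝ) : 0 ≤ angleWeight δ α := by
  unfold angleWeight; positivity

theorem angleWeight_le_one (δ α : ℝ) : angleWeight δ α ≤ 1 :=
  div_le_one_of_le₀ (by nlinarith [sq_nonneg (Real.sin α)]) (by positivity)

theorem angleWeight_neg (δ α : ℝ) : angleWeight δ (-α) = angleWeight δ α := by
  simp [angleWeight]

theorem measurable_angleWeight (δ : ℝ) : Measurable (angleWeight δ) := by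
  unfold angleWeight; fun_prop

theorem continuous_angleWeight {δ : ℝ} (hδ : 0 < δ) : Continuous (angleWeight δ) := by
  unfold angleWeight
  refine Continuous.div (by fun_prop) (by fun_prop) fun x => ?_
  positivity

theorem periodic_angleWeight (δ : ℝ) : Function.Periodic (angleWeight δ) Real.pi := by
  intro α
  simp [angleWeight, Real.sin_add_pi]

theorem integral_angleWeight_half_le {δ : ℝ} (hδ : 0 < δ) :
    ∫ α in (-(Real.pi / 2))..(Real.pi / 2), angleWeight δ α ≤ Real.pi ^ 2 / 2 * δ := by
  have hpi := Real.pi_pos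
  have hk : Real.pi * δ / 2 ≠ 0 := by positivity
  have hi : Integrable fun α : ℝ => (1 + (α / (Real.pi * δ / 2)) ^ 2)⁻¹ :=
    integrable_inv_one_add_sq.comp_div hk
  rw [intervalIntegral.integral_of_le (by linarith)]
  calc ∫ α in Set.Ioc (-(Real.pi / 2)) (Real.pi / 2), angleWeight δ α
      ≤ ∫ α in Set.Ioc (-(Real.pi / 2)) (Real.pi / 2), (1 + (α / (Real.pi * δ / 2)) ^ 2)⁻¹ := by
        refine setIntegral_mono_on ((continuous_angleWeight hδ).integrableOn_Ioc)
          hi.integrableOn measurableSet_Ioc fun α hα => ?_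
        have h1 := Real.mul_abs_le_abs_sin (x := α) (abs_le.2 ⟨hα.1.le, hα.2⟩)
        have h2 : (2 / Real.pi * |α|) ^ 2 ≤ Real.sin α ^ 2 := by
          rw [← sq_abs (Real.sin α)]
          exact pow_le_pow_left₀ (by positivity) h1 2
        rw [mul_pow, sq_abs] at h2
        have h3 : (1 + (α / (Real.pi * δ / 2)) ^ 2)⁻¹ =
            δ ^ 2 / (δ ^ 2 + (2 / Real.pi) ^ 2 * α ^ 2) := by
          field_simp
        rw [h3, angleWeight]
        exact div_le_div_of_nonneg_left (by positivity) (by positivity) (by linarith)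
    _ ≤ ∫ α : ℝ, (1 + (α / (Real.pi * δ / 2)) ^ 2)⁻¹ :=
        setIntegral_le_integral hi (ae_of_all _ fun α => by positivity)
    _ = _ := by
        rw [Measure.integral_comp_div (fun y : ℝ => (1 + y ^ 2)⁻¹), integral_univ_inv_one_add_sq,
          smul_eq_mul, abs_of_pos (by positivity)]
        ring

theorem integral_angleWeight_le {δ : ℝ} (hδ : 0 < δ) (φ : ℝ) :
    ∫ ψ, angleWeight δ (ψ - φ) ∂angleMeasure ≤ Real.pi ^ 2 * δ := by
  have hpi := Real.pi_pos
  have hper := periodic_angleWeight δ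
  have hii : ∀ a b, IntervalIntegrable (angleWeight δ) volume a b := fun a b =>
    (continuous_angleWeight hδ).intervalIntegrable a b
  have e0 : ∀ a, ∫ α in a..(a + Real.pi), angleWeight δ α ≤ Real.pi ^ 2 / 2 * δ := by
    intro a
    rw [hper.intervalIntegral_add_eq a (-(Real.pi / 2))]
    convert integral_angleWeight_half_le hδ using 2
    ring
  rw [integral_Ico_eq_integral_Ioc, ← intervalIntegral.integral_of_le (by linarith),
    intervalIntegral.integral_comp_sub_right (angleWeight δ) φ,
    ← intervalIntegral.integral_add_adjacent_intervals (hii _ (-Real.pi - φ + Real.pi)) (hii _ _),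
    show Real.pi - φ = -Real.pi - φ + Real.pi + Real.pi by ring]
  linarith [e0 (-Real.pi - φ), e0 (-Real.pi - φ + Real.pi)]

theorem integrable_exp_neg_norm_sq : Integrable fun x : Plane => Real.exp (-‖x‖ ^ 2) := by
  have h := (measurePreserving_rotation 0).integrable_comp_of_integrable
    (integrable_exp_neg_sq.mul_prod integrable_exp_neg_sq)
  refine h.congr (ae_of_all _ fun x => ?_)
  simp only [Function.comp]
  rw [norm_sq_rotation x 0, neg_add, Real.exp_add]

theorem integral_exp_mul_sq_integral_proj {E : ℝ × ℝ → ℝ} (hE : Measurable E) {K : ℝ}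
    (hK0 : 0 ≤ K) (hK : ∀ p, |E p| ≤ K) :
    (Integrable fun x : Plane => Real.exp (-‖x‖ ^ 2) * (∫ φ, E (proj (x, φ)) ∂angleMeasure) ^ 2) ∧
    ∫ x : Plane, Real.exp (-‖x‖ ^ 2) * (∫ φ, E (proj (x, φ)) ∂angleMeasure) ^ 2 =
      ∫ p : ℝ × ℝ, ridgePairing (fun t => E (t, p.1)) (fun t => E (t, p.2)) p.1 p.2
        ∂(angleMeasure.prod angleMeasure) := by
  have hm : Measurable fun z : Plane × ℝ => E (proj z) := hE.comp measurable_proj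
  have e : ∀ x : Plane, Real.exp (-‖x‖ ^ 2) * (∫ φ, E (proj (x, φ)) ∂angleMeasure) ^ 2 =
      ∫ p : ℝ × ℝ, Real.exp (-‖x‖ ^ 2) * (E (proj (x, p.1)) * E (proj (x, p.2)))
        ∂(angleMeasure.prod angleMeasure) := by
    intro x
    rw [integral_const_mul, integral_prod_mul (fun φ => E (proj (x, φ)))
      (fun φ => E (proj (x, φ))), ← pow_two]
  have hint : Integrable (Function.uncurry fun (x : Plane) (p : ℝ × ℝ) => Real.exp (-‖x‖ ^ 2) *
      (E (proj (x, p.1)) * E (proj (x, p.2))))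
      (volume.prod (angleMeasure.prod angleMeasure)) := by
    have hb : Integrable (fun q : Plane × (ℝ × ℝ) => Real.exp (-‖q.1‖ ^ 2) * (1 : ℝ))
        (volume.prod (angleMeasure.prod angleMeasure)) :=
      integrable_exp_neg_norm_sq.mul_prod (integrable_const (1 : ℝ))
    simp only [mul_one] at hb
    refine hb.mul_bdd (c := K * K) (g := fun q : Plane × (ℝ × ℝ) =>
      E (proj (q.1, q.2.1)) * E (proj (q.1, q.2.2))) ?_ (ae_of_all _ fun q => ?_)
    · exact Measurable.aestronglyMeasurable (Measurable.mul
        (hm.comp (measurable_fst.prodMk (measurable_fst.comp measurable_snd)))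
        (hm.comp (measurable_fst.prodMk (measurable_snd.comp measurable_snd))))
    · rw [norm_mul]
      exact mul_le_mul (hK _) (hK _) (norm_nonneg _) hK0
  simp only [e]
  refine ⟨hint.integral_prod_left, ?_⟩
  rw [integral_integral_swap hint]
  rfl

namespace BddSinogram

variable {g : ℝ × ℝ → ℝ} {δ : ℝ} {c : ℝ → ℝ}

theorem slice (hg : BddSinogram g) (φ : ℝ) : BddIntegrable fun s => g (s, φ) := by
  obtain ⟨K, hK⟩ := hg.bounded
  have hm : Measurable fun s => g (s, φ) := hg.measurable.comp measurable_prodMk_right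
  refine ⟨hm, ⟨K, fun s => hK _⟩, ?_⟩
  have h : IntegrableOn (fun s => g (s, φ)) (Set.Ioo (-1) 1) :=
    (integrable_const K).mono' hm.aestronglyMeasurable (ae_of_all _ fun s => hK _)
  refine (integrableOn_iff_integrable_of_support_subset fun s hs => ?_).1 h
  by_contra hs'
  exact hs (hg.support _ fun h => hs' h.1)

/-- The square integral of the slice at angle `φ`. -/
def _root_.PixelRadon.sliceSq (g : ℝ × ℝ → ℝ) (φ : ℝ) : ℝ := ∫ s, g (s, φ) ^ 2

theorem _root_.PixelRadon.sliceSq_nonneg (g : ℝ × ℝ → ℝ) (φ : ℝ) : 0 ≤ sliceSq g φ :=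
  integral_nonneg fun _ => sq_nonneg _

theorem sliceSq_eq (hg : BddSinogram g) (φ : ℝ) :
    sliceSq g φ = ∫ s in Set.Ioo (-1) 1, g (s, φ) ^ 2 := by
  refine (setIntegral_eq_integral_of_forall_compl_eq_zero fun s hs => ?_).symm
  rw [hg.support _ fun h => hs h.1]; simp

theorem measurable_sliceSq (hg : BddSinogram g) : Measurable (sliceSq g) :=
  (StronglyMeasurable.integral_prod_right (f := fun φ s => g (s, φ) ^ 2)
    ((hg.measurable.comp measurable_swap).pow_const 2).stronglyMeasurable).measurable

theorem sliceSq_integrable (hg : BddSinogram g) : Integrable (sliceSq g) angleMeasure := by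
  obtain ⟨K, hK⟩ := hg.bounded
  refine (integrable_const (2 * K ^ 2)).mono' hg.measurable_sliceSq.aestronglyMeasurable
    (ae_of_all _ fun φ => ?_)
  rw [Real.norm_eq_abs, abs_of_nonneg (sliceSq_nonneg _ _), hg.sliceSq_eq]
  calc ∫ s in Set.Ioo (-1) 1, g (s, φ) ^ 2 ≤ ∫ s in Set.Ioo (-1 : ℝ) 1, K ^ 2 :=
        setIntegral_mono (hg.slice φ).integrable_sq.integrableOn (integrable_const _) fun s =>
          sq_le_sq' (abs_le.1 (hK _)).1 (abs_le.1 (hK _)).2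
    _ = _ := by simp; norm_num

theorem integral_sliceSq (hg : BddSinogram g) :
    ∫ φ, sliceSq g φ ∂angleMeasure = ∫ y in Omega', g y ^ 2 := by
  simp only [hg.sliceSq_eq]
  obtain ⟨K, hK⟩ := hg.bounded
  rw [restrict_Omega', integral_prod_symm]
  refine (integrable_const (K ^ 2)).mono' (hg.measurable.pow_const 2).aestronglyMeasurable
    (ae_of_all _ fun y => ?_)
  rw [Real.norm_eq_abs, abs_of_nonneg (sq_nonneg _)]
  exact sq_le_sq' (abs_le.1 (hK _)).1 (abs_le.1 (hK _)).2

/-- The deviation of `g` from its average in the offset. -/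
def _root_.PixelRadon.sliceError (δ : ℝ) (c : ℝ → ℝ) (g : ℝ × ℝ → ℝ) (p : ℝ × ℝ) : ℝ :=
  smearError δ c (fun s => g (s, p.2)) p.1

theorem measurable_sliceError (hg : BddSinogram g) (hcm : Measurable c) :
    Measurable (sliceError δ c g) := by
  refine Measurable.sub ?_ hg.measurable
  refine (StronglyMeasurable.integral_prod_right
    (f := fun (p : ℝ × ℝ) s => hat δ (p.1 - c s) / δ ^ 2 * g (s, p.2))
    (Measurable.stronglyMeasurable ?_)).measurable
  have := (continuous_hat δ).measurable
  have := hg.measurable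
  simp only [Function.uncurry_def]
  fun_prop

/-- The backprojection of the deviation of `g` from its average in the offset. -/
def _root_.PixelRadon.backError (δ : ℝ) (c : ℝ → ℝ) (g : ℝ × ℝ → ℝ) (x : Plane) : ℝ :=
  ∫ φ, sliceError δ c g (proj (x, φ)) ∂angleMeasure

theorem measurable_backError (hg : BddSinogram g) (hcm : Measurable c) :
    Measurable (backError δ c g) :=
  (StronglyMeasurable.integral_prod_right
    (f := fun (x : Plane) φ => sliceError δ c g (proj (x, φ)))
    ((hg.measurable_sliceError hcm).comp measurable_proj).stronglyMeasurable).measurable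

theorem integral_exp_backError_sq (hg : BddSinogram g) (hδ : 0 < δ) (hcm : Measurable c)
    (hc : ∀ s, |c s - s| ≤ δ / 2) :
    (Integrable fun x : Plane => Real.exp (-‖x‖ ^ 2) * backError δ c g x ^ 2) ∧
    ∫ x : Plane, Real.exp (-‖x‖ ^ 2) * backError δ c g x ^ 2 =
      ∫ p : ℝ × ℝ, ridgePairing (smearError δ c fun s => g (s, p.1))
        (smearError δ c fun s => g (s, p.2)) p.1 p.2 ∂(angleMeasure.prod angleMeasure) := by
  obtain ⟨K, hK⟩ := hg.bounded
  exact integral_exp_mul_sq_integral_proj (hg.measurable_sliceError hcm)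
    (mul_nonneg (by norm_num : (0 : ℝ) ≤ 4) ((abs_nonneg _).trans (hK 0))) fun p =>
    abs_smearError_le_of_le hδ hc (hg.slice p.2) (fun s => hK _) p.1

theorem abs_ridgePairing_smearError_le (hg : BddSinogram g) (hδ : 0 < δ) (hcm : Measurable c)
    (hc : ∀ s, |c s - s| ≤ δ / 2) (φ ψ : ℝ) :
    |ridgePairing (smearError δ c fun s => g (s, φ)) (smearError δ c fun s => g (s, ψ)) φ ψ| ≤
      (10 * √Real.pi + 36 * √(2 * Real.pi)) *
        (angleWeight δ (ψ - φ) * (sliceSq g φ + sliceSq g ψ)) := by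
  have h₁ := (hg.slice φ).smearError hδ hcm hc
  have h₂ := (hg.slice ψ).smearError hδ hcm hc
  have p₁ := primitive_smearError_sq_le hδ hcm hc (hg.slice φ)
  have p₂ := primitive_smearError_sq_le hδ hcm hc (hg.slice ψ)
  have b₁ := abs_ridgePairing_le h₁ h₂ φ ψ
  have b₂ := sin_sq_mul_abs_ridgePairing_le h₁ h₂ p₁.1 p₂.1 φ ψ
  set J := |ridgePairing (smearError δ c fun s => g (s, φ))
    (smearError δ c fun s => g (s, ψ)) φ ψ|
  have b₁' : J ≤ 10 * √Real.pi * (sliceSq g φ + sliceSq g ψ) := by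
    refine b₁.trans ?_
    have l₁ := integral_smearError_sq_le hδ hcm hc (hg.slice φ)
    have l₂ := integral_smearError_sq_le hδ hcm hc (hg.slice ψ)
    calc _ ≤ √Real.pi / 2 * (20 * sliceSq g φ + 20 * sliceSq g ψ) :=
          mul_le_mul_of_nonneg_left (add_le_add l₁ l₂) (by positivity)
      _ = _ := by ring
  have b₂' : Real.sin (ψ - φ) ^ 2 * J ≤
      δ ^ 2 * (36 * √(2 * Real.pi) * (sliceSq g φ + sliceSq g ψ)) := by
    refine b₂.trans ?_
    calc _ ≤ 4 * √(2 * Real.pi) * (9 * δ ^ 2 * sliceSq g φ + 9 * δ ^ 2 * sliceSq g ψ) :=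
          mul_le_mul_of_nonneg_left (add_le_add p₁.2 p₂.2) (by positivity)
      _ = _ := by ring
  have hpos : 0 < δ ^ 2 + Real.sin (ψ - φ) ^ 2 := by positivity
  rw [angleWeight, div_mul_eq_mul_div, ← mul_div_assoc, le_div_iff₀ hpos]
  have := mul_le_mul_of_nonneg_left b₁' (sq_nonneg δ)
  linarith

theorem integral_angleWeight_mul_sliceSq_le (hg : BddSinogram g) (hδ : 0 < δ) :
    (Integrable (fun p : ℝ × ℝ => angleWeight δ (p.2 - p.1) * sliceSq g p.1)
      (angleMeasure.prod angleMeasure)) ∧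
    ∫ p : ℝ × ℝ, angleWeight δ (p.2 - p.1) * sliceSq g p.1 ∂(angleMeasure.prod angleMeasure) ≤
      Real.pi ^ 2 * δ * ∫ φ, sliceSq g φ ∂angleMeasure := by
  have hi : Integrable (fun p : ℝ × ℝ => angleWeight δ (p.2 - p.1) * sliceSq g p.1)
      (angleMeasure.prod angleMeasure) := by
    have h1 : Integrable (fun p : ℝ × ℝ => sliceSq g p.1) (angleMeasure.prod angleMeasure) :=
      hg.sliceSq_integrable.comp_fst _
    refine h1.bdd_mul (c := 1) ((measurable_angleWeight δ).comp
      (measurable_snd.sub measurable_fst)).aestronglyMeasurable (ae_of_all _ fun p => ?_)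
    rw [Real.norm_eq_abs, abs_of_nonneg (angleWeight_nonneg _ _)]
    exact angleWeight_le_one _ _
  refine ⟨hi, ?_⟩
  rw [integral_prod _ hi, ← integral_const_mul]
  refine integral_mono hi.integral_prod_left (hg.sliceSq_integrable.const_mul _) fun φ => ?_
  simp only
  rw [integral_mul_const]
  exact mul_le_mul_of_nonneg_right (integral_angleWeight_le hδ φ) (sliceSq_nonneg _ _)

theorem setIntegral_backError_sq_le (hg : BddSinogram g) (hδ : 0 < δ) (hcm : Measurable c)
    (hc : ∀ s, |c s - s| ≤ δ / 2) :
    IntegrableOn (fun x => backError δ c g x ^ 2) Omega ∧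
    ∫ x in Omega, backError δ c g x ^ 2 ≤
      Real.exp 1 * ((10 * √Real.pi + 36 * √(2 * Real.pi)) * (2 * Real.pi ^ 2)) * δ *
        ∫ y in Omega', g y ^ 2 := by
  obtain ⟨i0, e0⟩ := hg.integral_exp_backError_sq hδ hcm hc
  obtain ⟨i1, l1⟩ := hg.integral_angleWeight_mul_sliceSq_le hδ
  have i2' := i1.swap
  have i2 : Integrable (fun p : ℝ × ℝ => angleWeight δ (p.2 - p.1) * sliceSq g p.2)
      (angleMeasure.prod angleMeasure) := by
    refine i2'.congr (ae_of_all _ fun p => ?_)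
    simp only [Function.comp, Prod.fst_swap, Prod.snd_swap]
    rw [← angleWeight_neg, neg_sub]
  have l2 : ∫ p : ℝ × ℝ, angleWeight δ (p.2 - p.1) * sliceSq g p.2
      ∂(angleMeasure.prod angleMeasure) ≤ Real.pi ^ 2 * δ * ∫ φ, sliceSq g φ ∂angleMeasure := by
    refine le_trans (le_of_eq ?_) l1
    rw [← integral_prod_swap]
    refine integral_congr_ae (ae_of_all _ fun p => ?_)
    simp only [Prod.fst_swap, Prod.snd_swap]
    rw [← angleWeight_neg, neg_sub]
  set A := 10 * √Real.pi + 36 * √(2 * Real.pi) with hA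
  have hA0 : 0 ≤ A := by positivity
  have hdom : Integrable (fun p : ℝ × ℝ => A * (angleWeight δ (p.2 - p.1) *
      (sliceSq g p.1 + sliceSq g p.2))) (angleMeasure.prod angleMeasure) := by
    simp only [mul_add]
    exact (i1.const_mul _).add (i2.const_mul _)
  have main := norm_integral_le_of_norm_le (f := fun p : ℝ × ℝ =>
    ridgePairing (smearError δ c fun s => g (s, p.1)) (smearError δ c fun s => g (s, p.2)) p.1 p.2)
    hdom (ae_of_all _ fun p => hg.abs_ridgePairing_smearError_le hδ hcm hc p.1 p.2)
  rw [← e0, integral_const_mul] at main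
  simp only [mul_add] at main
  rw [integral_add i1 i2] at main
  have hle : ∀ x ∈ Omega, backError δ c g x ^ 2 ≤
      Real.exp 1 * (Real.exp (-‖x‖ ^ 2) * backError δ c g x ^ 2) := by
    intro x hx
    rw [Omega, mem_ball_zero_iff] at hx
    rw [← mul_assoc, ← Real.exp_add]
    refine le_mul_of_one_le_left (sq_nonneg _) (Real.one_le_exp ?_)
    nlinarith [norm_nonneg x]
  have hi : IntegrableOn (fun x => backError δ c g x ^ 2) Omega := by
    refine ((i0.const_mul (Real.exp 1)).integrableOn (s := Omega)).mono'
      ((hg.measurable_backError hcm).pow_const 2).aestronglyMeasurable ?_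
    filter_upwards [ae_restrict_mem measurableSet_Omega] with x hx
    rw [Real.norm_eq_abs, abs_of_nonneg (sq_nonneg _)]
    exact hle x hx
  refine ⟨hi, ?_⟩
  calc ∫ x in Omega, backError δ c g x ^ 2
      ≤ ∫ x in Omega, Real.exp 1 * (Real.exp (-‖x‖ ^ 2) * backError δ c g x ^ 2) :=
        setIntegral_mono_on hi (i0.const_mul _).integrableOn measurableSet_Omega hle
    _ ≤ ∫ x, Real.exp 1 * (Real.exp (-‖x‖ ^ 2) * backError δ c g x ^ 2) :=
        setIntegral_le_integral (i0.const_mul _) (ae_of_all _ fun x => by positivity)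
    _ = Real.exp 1 * ∫ x, Real.exp (-‖x‖ ^ 2) * backError δ c g x ^ 2 := integral_const_mul _ _
    _ ≤ Real.exp 1 * (A * (Real.pi ^ 2 * δ * (∫ y in Omega', g y ^ 2) +
          Real.pi ^ 2 * δ * ∫ y in Omega', g y ^ 2)) := by
        rw [hg.integral_sliceSq] at l1 l2
        refine mul_le_mul_of_nonneg_left (((le_abs_self _).trans main).trans ?_)
          (Real.exp_pos _).le
        exact mul_le_mul_of_nonneg_left (add_le_add l1 l2) hA0
    _ = _ := by ring

end BddSinogram

/-! ### The cells of a discretization -/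

theorem norm_theta (φ : ℝ) : ‖theta φ‖ = 1 := by
  have h := norm_sq_rotation (theta φ) φ
  rw [inner_theta, inner_theta, Real.cos_add_pi_div_two, Real.sin_add_pi_div_two] at h
  simp only [theta, Matrix.cons_val_zero, Matrix.cons_val_one] at h
  have h2 := Real.sin_sq_add_cos_sq φ
  have h3 : ‖theta φ‖ ^ 2 = 1 := by
    rw [theta, h]
    linear_combination (Real.sin φ ^ 2 + Real.cos φ ^ 2 + 1) * h2
  nlinarith [norm_nonneg (theta φ)]

theorem norm_theta_sub_le (φ ψ : ℝ) : ‖theta φ - theta ψ‖ ≤ |φ - ψ| := by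
  rw [EuclideanSpace.norm_eq]
  refine Real.sqrt_le_iff.2 ⟨abs_nonneg _, ?_⟩
  simp only [theta, Fin.sum_univ_two, PiLp.sub_apply, Matrix.cons_val_zero, Matrix.cons_val_one,
    Real.norm_eq_abs, sq_abs]
  have h := Real.one_sub_sq_div_two_le_cos (x := φ - ψ)
  rw [Real.cos_sub] at h
  nlinarith [Real.sin_sq_add_cos_sq φ, Real.sin_sq_add_cos_sq ψ]

theorem theta_add_int_mul_two_pi (φ : ℝ) (k : ℤ) : theta (φ + 2 * Real.pi * k) = theta φ := by
  rw [theta, theta, mul_comm (2 * Real.pi), Real.cos_add_int_mul_two_pi,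
    Real.sin_add_int_mul_two_pi]

theorem eq_of_mem_gridCell {δ a x : ℝ} (hδ : 0 < δ) {i j : ℕ}
    (hi : x - δ * ((i : ℝ) - a) ∈ Set.Ico (-(δ / 2)) (δ / 2))
    (hj : x - δ * ((j : ℝ) - a) ∈ Set.Ico (-(δ / 2)) (δ / 2)) : i = j := by
  have h1 : (i : ℝ) < j + 1 := by
    by_contra! h
    nlinarith [hi.1, hj.2]
  have h2 : (j : ℝ) < i + 1 := by
    by_contra! h
    nlinarith [hi.2, hj.1]
  have h1' : i < j + 1 := by exact_mod_cast h1
  have h2' : j < i + 1 := by exact_mod_cast h2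
  omega

namespace Grid

variable (D : Grid)

/-- The centre of the offset cell containing `s`, for the offset cells continued to the line. -/
def cellCenter (s : ℝ) : ℝ := D.δs * (⌊s / D.δs + D.P / 2⌋ + (1 - D.P) / 2)

theorem measurable_cellCenter : Measurable D.cellCenter := by
  unfold cellCenter
  have : Measurable fun s : ℝ => ((⌊s / D.δs + D.P / 2⌋ : ℤ) : ℝ) :=
    (measurable_of_countable _).comp
      (Int.measurable_floor.comp ((measurable_id.div_const _).add_const _))
  fun_prop

theorem abs_cellCenter_sub_le (s : ℝ) : |D.cellCenter s - s| ≤ D.δs / 2 := by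
  have hδ := D.δs_pos
  have h1 := Int.floor_le (s / D.δs + D.P / 2)
  have h2 := Int.lt_floor_add_one (s / D.δs + D.P / 2)
  have e : s = D.δs * (s / D.δs) := by field_simp
  set n : ℝ := ((⌊s / D.δs + D.P / 2⌋ : ℤ) : ℝ)
  have e2 : D.cellCenter s - s = D.δs * (n + (1 - D.P) / 2 - s / D.δs) := by
    change D.δs * (n + (1 - D.P) / 2) - s = _
    linear_combination (-1 : ℝ) * e
  rw [e2, abs_mul, abs_of_pos hδ, div_eq_mul_inv]
  refine mul_le_mul_of_nonneg_left (abs_le.2 ⟨?_, ?_⟩) hδ.le <;> linarith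

theorem cellCenter_eq {s : ℝ} {p : ℕ} (h : s ∈ D.offsetCell p) : D.cellCenter s = D.offset p := by
  have hδ := D.δs_pos
  have e : s = D.δs * (s / D.δs) := by field_simp
  simp only [offsetCell, offset, Set.mem_Ico] at h
  have hf : ⌊s / D.δs + D.P / 2⌋ = (p : ℤ) - 1 := by
    rw [Int.floor_eq_iff]
    push_cast
    rw [e] at h
    constructor <;> nlinarith [h.1, h.2]
  rw [cellCenter, hf, offset]
  push_cast
  ring

theorem offsetCell_unique {s : ℝ} {p p' : ℕ} (h : s ∈ D.offsetCell p)
    (h' : s ∈ D.offsetCell p') : p = p' := by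
  refine eq_of_mem_gridCell (x := s) (a := ((D.P : ℝ) + 1) / 2) D.δs_pos ?_ ?_
  · simp only [offsetCell, offset, Set.mem_Ico] at h ⊢; constructor <;> linarith
  · simp only [offsetCell, offset, Set.mem_Ico] at h' ⊢; constructor <;> linarith

theorem pixel_unique {x : Plane} {i j i' j' : ℕ} (h : x ∈ D.pixel i j) (h' : x ∈ D.pixel i' j') :
    i = i' ∧ j = j' :=
  ⟨eq_of_mem_gridCell D.δx_pos (h 0) (h' 0), eq_of_mem_gridCell D.δx_pos (h 1) (h' 1)⟩

theorem norm_center_sub_le {x : Plane} {i j : ℕ} (h : x ∈ D.pixel i j) :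
    ‖D.center i j - x‖ ≤ D.δx := by
  have hδ := D.δx_pos
  rw [EuclideanSpace.norm_eq]
  refine Real.sqrt_le_iff.2 ⟨hδ.le, ?_⟩
  simp only [Fin.sum_univ_two, PiLp.sub_apply, Real.norm_eq_abs, sq_abs]
  have h0 := h 0
  have h1 := h 1
  rw [Set.mem_Ico] at h0 h1
  nlinarith [h0.1, h0.2, h1.1, h1.2]

theorem φ_le_succ {q : ℕ} (hq : q ≤ D.Q) : D.φ q ≤ D.φ (q + 1) := by
  have hQ := D.Q_pos
  have hpi := Real.pi_pos
  rcases Nat.eq_zero_or_pos q with rfl | h0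
  · have h1 := D.φ_mem 1 (Finset.mem_Icc.2 ⟨le_rfl, hQ⟩)
    have h2 := D.φ_mem D.Q (Finset.mem_Icc.2 ⟨hQ, le_rfl⟩)
    rw [D.φ_zero]
    linarith [h1.1, h2.2]
  · rcases hq.eq_or_lt with rfl | h
    · have h1 := D.φ_mem 1 (Finset.mem_Icc.2 ⟨le_rfl, hQ⟩)
      have h2 := D.φ_mem D.Q (Finset.mem_Icc.2 ⟨hQ, le_rfl⟩)
      rw [D.φ_succ]
      linarith [h1.1, h2.2]
    · exact (D.φ_lt q (Finset.mem_Icc.2 ⟨h0, hq⟩) (q + 1) (Finset.mem_Icc.2 ⟨by omega, h⟩)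
        (Nat.lt_succ_self q)).le

/-- The lower end of the `q`-th angular cell. -/
def angleMid (q : ℕ) : ℝ := (D.φ (q - 1) + D.φ q) / 2

theorem angleMid_mono {q q' : ℕ} (h1 : 1 ≤ q) (h : q ≤ q') (h' : q' ≤ D.Q + 1) :
    D.angleMid q ≤ D.angleMid q' := by
  induction q', h using Nat.le_induction with
  | base => exact le_rfl
  | succ n hn ih =>
    refine (ih (by omega)).trans ?_
    have e1 := D.φ_le_succ (q := n - 1) (by omega)
    have e2 := D.φ_le_succ (q := n) (by omega)
    rw [Nat.sub_add_cancel (by omega)] at e1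
    unfold angleMid
    rw [Nat.add_sub_cancel]
    linarith

theorem angleMid_succ : D.angleMid (D.Q + 1) = D.angleMid 1 + 2 * Real.pi := by
  unfold angleMid
  rw [Nat.add_sub_cancel, Nat.sub_self, D.φ_succ, D.φ_zero]; ring

theorem angleCell_unique {φ : ℝ} {q q' : ℕ} (hq : q ∈ Finset.Icc 1 D.Q)
    (hq' : q' ∈ Finset.Icc 1 D.Q) (h : φ ∈ D.angleCell q) (h' : φ ∈ D.angleCell q') : q = q' := by
  have hpi := Real.pi_pos
  rw [Finset.mem_Icc] at hq hq'
  obtain ⟨k, hk⟩ := h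
  obtain ⟨k', hk'⟩ := h'
  change φ + 2 * Real.pi * k ∈ Set.Ico (D.angleMid q) (D.angleMid (q + 1)) at hk
  change φ + 2 * Real.pi * k' ∈ Set.Ico (D.angleMid q') (D.angleMid (q' + 1)) at hk'
  have a1 := D.angleMid_mono le_rfl hq.1 (by omega)
  have a2 := D.angleMid_mono (q := q + 1) (by omega) (by omega : q + 1 ≤ D.Q + 1) le_rfl
  have b1 := D.angleMid_mono le_rfl hq'.1 (by omega)
  have b2 := D.angleMid_mono (q := q' + 1) (by omega) (by omega : q' + 1 ≤ D.Q + 1) le_rfl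
  have e := D.angleMid_succ
  have hkk : k = k' := by
    have h1 : (k : ℝ) < k' + 1 := by
      by_contra! h
      nlinarith [hk.2, hk'.1]
    have h2 : (k' : ℝ) < k + 1 := by
      by_contra! h
      nlinarith [hk'.2, hk.1]
    have h1' : k < k' + 1 := by exact_mod_cast h1
    have h2' : k' < k + 1 := by exact_mod_cast h2
    omega
  subst hkk
  rcases lt_trichotomy q q' with h | h | h
  · have := D.angleMid_mono (q := q + 1) (by omega) h (by omega)
    linarith [hk.2, hk'.1]
  · exact h
  · have := D.angleMid_mono (q := q' + 1) (by omega) h (by omega)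
    linarith [hk'.2, hk.1]

theorem φ_succ_sub_le {q : ℕ} (hq : q ∈ Finset.Icc 1 D.Q) : D.φ (q + 1) - D.φ q ≤ D.δφ :=
  Finset.le_sup' (fun q => D.φ (q + 1) - D.φ q) hq

theorem φ_sub_pred_le {q : ℕ} (hq : q ∈ Finset.Icc 1 D.Q) : D.φ q - D.φ (q - 1) ≤ D.δφ := by
  rw [Finset.mem_Icc] at hq
  rcases hq.1.eq_or_lt with rfl | h
  · have := D.φ_succ_sub_le (Finset.mem_Icc.2 ⟨D.Q_pos, le_rfl⟩)
    rw [D.φ_succ] at this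
    rw [Nat.sub_self, D.φ_zero]
    linarith
  · have := D.φ_succ_sub_le (q := q - 1) (Finset.mem_Icc.2 ⟨by omega, by omega⟩)
    rwa [Nat.sub_add_cancel hq.1] at this

theorem δφ_nonneg : 0 ≤ D.δφ :=
  (sub_nonneg.2 (D.φ_le_succ D.Q_pos)).trans
    (D.φ_succ_sub_le (Finset.mem_Icc.2 ⟨le_rfl, D.Q_pos⟩))

theorem norm_theta_sub_le_of_mem {φ : ℝ} {q : ℕ} (hq : q ∈ Finset.Icc 1 D.Q)
    (h : φ ∈ D.angleCell q) : ‖theta (D.φ q) - theta φ‖ ≤ D.δφ := by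
  obtain ⟨k, hk⟩ := h
  rw [← theta_add_int_mul_two_pi φ k]
  refine (norm_theta_sub_le _ _).trans (abs_le.2 ?_)
  have h1 := D.φ_succ_sub_le hq
  have h2 := D.φ_sub_pred_le hq
  have h3 := D.δφ_nonneg
  constructor <;> linarith [hk.1, hk.2]

theorem abs_inner_center_sub_le {x : Plane} (hx : x ∈ Omega) {φ : ℝ} {q i j : ℕ}
    (hq : q ∈ Finset.Icc 1 D.Q) (hφ : φ ∈ D.angleCell q) (hij : x ∈ D.pixel i j) :
    |(inner ℝ (D.center i j) (theta (D.φ q)) : ℝ) - inner ℝ x (theta φ)| ≤ D.δx + D.δφ := by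
  rw [Omega, mem_ball_zero_iff] at hx
  have e : (inner ℝ (D.center i j) (theta (D.φ q)) : ℝ) - inner ℝ x (theta φ) =
      inner ℝ (D.center i j - x) (theta (D.φ q)) + inner ℝ x (theta (D.φ q) - theta φ) := by
    rw [inner_sub_left, inner_sub_right]; ring
  rw [e]
  refine (abs_add_le _ _).trans (add_le_add ?_ ?_)
  · refine (abs_real_inner_le_norm _ _).trans ?_
    rw [norm_theta, mul_one]
    exact D.norm_center_sub_le hij
  · refine (abs_real_inner_le_norm _ _).trans ?_
    exact (mul_le_of_le_one_left (norm_nonneg _) hx.le).trans (D.norm_theta_sub_le_of_mem hq hφ)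

/-! ### The kernel of the discrete transform -/

/-- The integral kernel of the fully discrete Radon transform. -/
def kernel (x : Plane) (y : ℝ × ℝ) : ℝ :=
  1 / D.δs ^ 2 * ∑ p ∈ Finset.Icc 1 D.P, ∑ q ∈ Finset.Icc 1 D.Q,
    (D.offsetCell p).indicator 1 y.1 * (D.angleCell q).indicator 1 y.2 *
      ∑ i ∈ Finset.Icc 1 D.N, ∑ j ∈ Finset.Icc 1 D.M,
        hat D.δs (inner ℝ (D.center i j) (theta (D.φ q)) - D.offset p) *
          (D.pixel i j).indicator 1 x

/-- The integral kernel of the transform discretized in the offset only. -/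
def offsetKernel (x : Plane) (y : ℝ × ℝ) : ℝ :=
  hat D.δs (inner ℝ x (theta y.2) - D.cellCenter y.1) / D.δs ^ 2

theorem measurable_offsetKernel : Measurable fun z : Plane × (ℝ × ℝ) => D.offsetKernel z.1 z.2 := by
  have h1 := D.measurable_cellCenter
  have h2 := (continuous_hat D.δs).measurable
  have h3 : Measurable fun z : Plane × (ℝ × ℝ) => (inner ℝ z.1 (theta z.2.2) : ℝ) :=
    measurable_fst.inner (measurable_theta.comp (measurable_snd.comp measurable_snd))
  exact (h2.comp (h3.sub (h1.comp (measurable_fst.comp measurable_snd)))).div_const _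

theorem abs_offsetKernel_le (x : Plane) (y : ℝ × ℝ) : |D.offsetKernel x y| ≤ 1 / D.δs := by
  have hδ := D.δs_pos
  rw [offsetKernel, abs_of_nonneg (div_nonneg (hat_nonneg _ _) (sq_nonneg _)),
    div_le_div_iff₀ (by positivity) hδ]
  nlinarith [hat_le hδ.le (inner ℝ x (theta y.2) - D.cellCenter y.1)]

theorem measurable_kernel : Measurable fun z : Plane × (ℝ × ℝ) => D.kernel z.1 z.2 := by
  unfold kernel
  refine Measurable.const_mul (Finset.measurable_sum _ fun p _ => Finset.measurable_sum _ fun q _ =>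
    Measurable.mul (Measurable.mul ?_ ?_) (Finset.measurable_sum _ fun i _ =>
      Finset.measurable_sum _ fun j _ => Measurable.const_mul ?_ _)) _
  · exact (measurable_one.indicator measurableSet_Ico).comp (measurable_fst.comp measurable_snd)
  · exact (measurable_one.indicator (D.measurableSet_angleCell q)).comp
      (measurable_snd.comp measurable_snd)
  · exact (measurable_one.indicator (D.measurableSet_pixel i j)).comp measurable_fst

theorem kernel_eq {x : Plane} {y : ℝ × ℝ} {p q i j : ℕ} (hp : p ∈ Finset.Icc 1 D.P)
    (hq : q ∈ Finset.Icc 1 D.Q) (hi : i ∈ Finset.Icc 1 D.N) (hj : j ∈ Finset.Icc 1 D.M)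
    (hy : y ∈ D.offsetCell p ×ˢ D.angleCell q) (hx : x ∈ D.pixel i j) :
    D.kernel x y =
      hat D.δs (inner ℝ (D.center i j) (theta (D.φ q)) - D.offset p) / D.δs ^ 2 := by
  rw [kernel, Finset.sum_eq_single_of_mem p hp fun p' _ hne => ?_,
    Finset.sum_eq_single_of_mem q hq fun q' hq' hne => ?_,
    Finset.sum_eq_single_of_mem i hi fun i' _ hne => ?_,
    Finset.sum_eq_single_of_mem j hj fun j' _ hne => ?_]
  · rw [Set.indicator_of_mem hy.1, Set.indicator_of_mem hy.2, Set.indicator_of_mem hx]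
    simp only [Pi.one_apply]; ring
  · rw [Set.indicator_of_notMem fun h => hne (D.pixel_unique h hx).2, mul_zero]
  · refine Finset.sum_eq_zero fun j' _ => ?_
    rw [Set.indicator_of_notMem fun h => hne (D.pixel_unique h hx).1, mul_zero]
  · rw [Set.indicator_of_notMem (s := D.angleCell q')
      fun h => hne (D.angleCell_unique hq' hq h hy.2)]
    simp
  · refine Finset.sum_eq_zero fun q' _ => ?_
    rw [Set.indicator_of_notMem fun h => hne (D.offsetCell_unique h hy.1)]
    simp

variable {D}

theorem Compatible.abs_kernel_sub_le (hD : D.Compatible) {x : Plane} (hx : x ∈ Omega) {y : ℝ × ℝ}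
    (hy : y ∈ Omega') : |D.kernel x y - D.offsetKernel x y| ≤ (D.δx + D.δφ) / D.δs ^ 2 *
      window (3 / 2 * D.δs + (D.δx + D.δφ)) (inner ℝ x (theta y.2) - y.1) := by
  have hδ := D.δs_pos
  have h1 := hD.image hx
  have h2 := hD.sinogram hy
  simp only [Set.mem_iUnion] at h1 h2
  obtain ⟨i, hi, j, hj, hij⟩ := h1
  obtain ⟨p, hp, q, hq, hpq⟩ := h2
  have hin := D.abs_inner_center_sub_le hx hq hpq.2 hij
  rw [D.kernel_eq hp hq hi hj hpq hij, offsetKernel, D.cellCenter_eq hpq.1, ← sub_div, abs_div,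
    abs_of_nonneg (sq_nonneg D.δs), div_mul_eq_mul_div]
  refine div_le_div_of_nonneg_right ?_ (sq_nonneg _)
  set a : ℝ := inner ℝ (D.center i j) (theta (D.φ q))
  set b : ℝ := inner ℝ x (theta y.2)
  by_cases h : |b - y.1| ≤ 3 / 2 * D.δs + (D.δx + D.δφ)
  · rw [window_of_le h, mul_one]
    refine (abs_hat_sub_hat_le _ _ _).trans ?_
    rwa [sub_sub_sub_cancel_right]
  · rw [window_of_lt (not_le.1 h), mul_zero]
    rw [not_le] at h
    have hc := D.abs_cellCenter_sub_le y.1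
    rw [D.cellCenter_eq hpq.1] at hc
    have hb : D.δs + (D.δx + D.δφ) ≤ |b - D.offset p| := by
      have := abs_sub_le b (D.offset p) y.1
      linarith
    have ha : D.δs ≤ |a - D.offset p| := by
      have := abs_sub_le b a (D.offset p)
      rw [abs_sub_comm b a] at this
      linarith
    have := D.δφ_nonneg
    have := D.δx_pos
    rw [hat_eq_zero ha, hat_eq_zero (by linarith), sub_zero, abs_zero]

theorem discreteRadonFun_eq_integral (D : Grid) {f : Plane → ℝ}
    (hf : Integrable f (volume.restrict Omega)) (y : ℝ × ℝ) :
    D.discreteRadonFun f y = ∫ x in Omega, D.kernel x y * f x := by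
  have hδ := D.δx_pos
  have hi : ∀ i j, Integrable (fun x => (D.pixel i j).indicator 1 x * f x)
      (volume.restrict Omega) := by
    intro i j
    refine (hf.indicator (D.measurableSet_pixel i j)).congr (ae_of_all _ fun x => ?_)
    by_cases h : x ∈ D.pixel i j <;> simp [h]
  have hm : ∀ i j, D.pixelMean f i j =
      1 / D.δx ^ 2 * ∫ x in Omega, (D.pixel i j).indicator 1 x * f x := by
    intro i j
    rw [D.pixelMean_eq, ← integral_indicator (D.measurableSet_pixel i j)]
    congr 1
    refine integral_congr_ae (ae_of_all _ fun x => ?_)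
    by_cases h : x ∈ D.pixel i j <;> simp [h]
  have e : ∀ x, D.kernel x y * f x = ∑ p ∈ Finset.Icc 1 D.P, ∑ q ∈ Finset.Icc 1 D.Q,
      ∑ i ∈ Finset.Icc 1 D.N, ∑ j ∈ Finset.Icc 1 D.M, (1 / D.δs ^ 2 *
        ((D.offsetCell p).indicator 1 y.1 * (D.angleCell q).indicator 1 y.2 *
        hat D.δs (inner ℝ (D.center i j) (theta (D.φ q)) - D.offset p))) *
          ((D.pixel i j).indicator 1 x * f x) := by
    intro x
    simp only [kernel, Finset.mul_sum, Finset.sum_mul]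
    refine Finset.sum_congr rfl fun p _ => Finset.sum_congr rfl fun q _ =>
      Finset.sum_congr rfl fun i _ => Finset.sum_congr rfl fun j _ => ?_
    ring
  simp only [e]
  have hi' := fun (a : ℝ) i j => (hi i j).const_mul a
  rw [integral_finsetSum _ fun p _ => integrable_finsetSum _ fun q _ =>
    integrable_finsetSum _ fun i _ => integrable_finsetSum _ fun j _ => hi' _ i j]
  rw [discreteRadonFun, Finset.mul_sum]
  refine Finset.sum_congr rfl fun p _ => ?_
  rw [integral_finsetSum _ fun q _ =>
    integrable_finsetSum _ fun i _ => integrable_finsetSum _ fun j _ => hi' _ i j, Finset.mul_sum]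
  refine Finset.sum_congr rfl fun q _ => ?_
  rw [integral_finsetSum _ fun i _ => integrable_finsetSum _ fun j _ => hi' _ i j,
    Finset.mul_sum, Finset.mul_sum]
  refine Finset.sum_congr rfl fun i _ => ?_
  rw [integral_finsetSum _ fun j _ => hi' _ i j, Finset.mul_sum, Finset.mul_sum]
  refine Finset.sum_congr rfl fun j _ => ?_
  rw [integral_const_mul, hm]
  field_simp

end Grid

/-! ### The Schur test -/

/-- The mass of a strip of half-width `ρ` in the image domain. -/
theorem setIntegral_window_Omega_le {ρ : ℝ} (hρ : 0 ≤ ρ) (φ s : ℝ) :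
    ∫ x in Omega, window ρ (inner ℝ x (theta φ) - s) ≤ 4 * ρ := by
  have hA : MeasurableSet (Set.Icc (s - ρ) (s + ρ)) := measurableSet_Icc
  have hms : MeasurableSet {x : Plane | inner ℝ x (theta φ) ∈ Set.Icc (s - ρ) (s + ρ)} :=
    (measurable_id.inner_const) hA
  have e : ∀ x : Plane, window ρ (inner ℝ x (theta φ) - s) =
      {x : Plane | inner ℝ x (theta φ) ∈ Set.Icc (s - ρ) (s + ρ)}.indicator 1 x := by
    intro x
    by_cases h : |inner ℝ x (theta φ) - s| ≤ ρ
    · rw [window_of_le h, Set.indicator_of_mem]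
      · rfl
      · rw [abs_le] at h
        exact ⟨by linarith, by linarith⟩
    · rw [window_of_lt (not_le.1 h), Set.indicator_of_notMem]
      intro h'
      exact h (abs_le.2 ⟨by linarith [h'.1], by linarith [h'.2]⟩)
  simp only [e]
  rw [integral_indicator_one hms, Measure.real]
  refine ENNReal.toReal_le_of_le_ofReal (by positivity) ((strip_le φ hA).trans ?_)
  calc 2 * (volume : Measure ℝ).restrict (Set.Ioo (-1) 1) (Set.Icc (s - ρ) (s + ρ))
      ≤ 2 * volume (Set.Icc (s - ρ) (s + ρ)) := by
        gcongr; exact Measure.restrict_le_self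
    _ = ENNReal.ofReal 2 * ENNReal.ofReal (2 * ρ) := by
        rw [Real.volume_Icc, ENNReal.ofReal_ofNat]; congr 2; ring
    _ = ENNReal.ofReal (4 * ρ) := by
        rw [← ENNReal.ofReal_mul (by norm_num)]; congr 1; ring

theorem measurable_window_proj (ρ : ℝ) :
    Measurable fun z : Plane × (ℝ × ℝ) => window ρ (inner ℝ z.1 (theta z.2.2) - z.2.1) :=
  (measurable_window ρ).comp ((measurable_fst.inner (measurable_theta.comp
    (measurable_snd.comp measurable_snd))).sub (measurable_fst.comp measurable_snd))

theorem setIntegral_window_Omega'_le {ρ : ℝ} (hρ : 0 ≤ ρ) (x : Plane) :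
    ∫ y in Omega', window ρ (inner ℝ x (theta y.2) - y.1) ≤ 4 * Real.pi * ρ := by
  have hi : Integrable (fun y : ℝ × ℝ => window ρ (inner ℝ x (theta y.2) - y.1))
      (volume.restrict Omega') :=
    (integrable_const (1 : ℝ)).mono'
      ((measurable_window_proj ρ).comp measurable_prodMk_left).aestronglyMeasurable
      (ae_of_all _ fun y => by
        rw [Real.norm_eq_abs, abs_of_nonneg (window_nonneg _ _)]; exact window_le_one _ _)
  rw [restrict_Omega'] at hi ⊢
  rw [integral_prod_symm _ hi]
  calc _ ≤ ∫ φ, 2 * ρ ∂angleMeasure := by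
        refine integral_mono hi.integral_prod_right (integrable_const _) fun φ => ?_
        refine (setIntegral_le_integral (f := fun s => window ρ (inner ℝ x (theta φ) - s))
          ((integrable_window ρ).comp_sub_left _) (ae_of_all _ fun s => window_nonneg _ _)).trans ?_
        rw [integral_sub_left_eq_self (window ρ), integral_window hρ]
    _ = _ := by
        have := Real.pi_pos
        rw [integral_const, smul_eq_mul, Measure.real, Measure.restrict_apply_univ,
          Real.volume_Ico, ENNReal.toReal_ofReal (by linarith)]
        ring

theorem window_mul_integrable {ρ : ℝ} {F : (ℝ × ℝ) × Plane → ℝ}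
    (hF : Integrable F ((volume.restrict Omega').prod (volume.restrict Omega))) :
    Integrable (fun z : (ℝ × ℝ) × Plane => window ρ (inner ℝ z.2 (theta z.1.2) - z.1.1) * F z)
      ((volume.restrict Omega').prod (volume.restrict Omega)) := by
  refine hF.bdd_mul (c := 1) ((measurable_window_proj ρ).comp
    measurable_swap).aestronglyMeasurable (ae_of_all _ fun z => ?_)
  rw [Real.norm_eq_abs]
  exact (abs_of_nonneg (window_nonneg _ _)).trans_le (window_le_one _ _)

theorem integral_window_mul_sq_right_le {ρ : ℝ} (hρ : 0 ≤ ρ) {f : Plane → ℝ}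
    (hf : Integrable (fun x => f x ^ 2) (volume.restrict Omega)) :
    Integrable (fun z : (ℝ × ℝ) × Plane =>
        window ρ (inner ℝ z.2 (theta z.1.2) - z.1.1) * f z.2 ^ 2)
      ((volume.restrict Omega').prod (volume.restrict Omega)) ∧
    ∫ z : (ℝ × ℝ) × Plane, window ρ (inner ℝ z.2 (theta z.1.2) - z.1.1) * f z.2 ^ 2
      ∂((volume.restrict Omega').prod (volume.restrict Omega)) ≤
      4 * Real.pi * ρ * ∫ x in Omega, f x ^ 2 := by
  have i1 := window_mul_integrable (ρ := ρ) (F := fun z => f z.2 ^ 2)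
    (hf.comp_snd (volume.restrict Omega'))
  refine ⟨i1, ?_⟩
  rw [integral_prod_symm _ i1, ← integral_const_mul]
  refine integral_mono i1.integral_prod_right (hf.const_mul _) fun x => ?_
  simp only
  rw [integral_mul_const]
  exact mul_le_mul_of_nonneg_right (setIntegral_window_Omega'_le hρ x) (sq_nonneg _)

theorem integral_window_mul_sq_left_le {ρ : ℝ} (hρ : 0 ≤ ρ) {g : ℝ × ℝ → ℝ}
    (hg : Integrable (fun y => g y ^ 2) (volume.restrict Omega')) :
    Integrable (fun z : (ℝ × ℝ) × Plane =>
        window ρ (inner ℝ z.2 (theta z.1.2) - z.1.1) * g z.1 ^ 2)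
      ((volume.restrict Omega').prod (volume.restrict Omega)) ∧
    ∫ z : (ℝ × ℝ) × Plane, window ρ (inner ℝ z.2 (theta z.1.2) - z.1.1) * g z.1 ^ 2
      ∂((volume.restrict Omega').prod (volume.restrict Omega)) ≤
      4 * ρ * ∫ y in Omega', g y ^ 2 := by
  have i2 := window_mul_integrable (ρ := ρ) (F := fun z => g z.1 ^ 2)
    (hg.comp_fst (volume.restrict Omega))
  refine ⟨i2, ?_⟩
  rw [integral_prod _ i2, ← integral_const_mul]
  refine integral_mono i2.integral_prod_left (hg.const_mul _) fun y => ?_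
  simp only
  rw [integral_mul_const]
  exact mul_le_mul_of_nonneg_right (setIntegral_window_Omega_le hρ _ _) (sq_nonneg _)

theorem norm_mul_integral_kernel_le {η : ℝ} {w L f : Plane → ℝ} (hwm : Measurable w)
    (hw0 : ∀ x, 0 ≤ w x) (hw1 : ∀ x, w x ≤ 1) (hL : ∀ x ∈ Omega, |L x| ≤ η * w x)
    (hf : Integrable (fun x => f x ^ 2) (volume.restrict Omega)) (a : ℝ) :
    ‖a * ∫ x in Omega, L x * f x‖ ≤
      ∫ x in Omega, η / 2 * (w x * f x ^ 2 + w x * a ^ 2) := by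
  have hb : ∀ᵐ x ∂(volume : Measure Plane).restrict Omega, ‖w x‖ ≤ 1 := ae_of_all _ fun x => by
    rw [Real.norm_eq_abs, abs_of_nonneg (hw0 x)]; exact hw1 x
  have i1 : Integrable (fun x => w x * f x ^ 2) (volume.restrict Omega) :=
    hf.bdd_mul hwm.aestronglyMeasurable hb
  have i2 : Integrable (fun x => w x * a ^ 2) (volume.restrict Omega) :=
    (integrable_const (a ^ 2)).bdd_mul hwm.aestronglyMeasurable hb
  rw [← integral_const_mul]
  refine norm_integral_le_of_norm_le (f := fun x => a * (L x * f x))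
    ((i1.add i2).const_mul (η / 2)) ?_
  filter_upwards [ae_restrict_mem measurableSet_Omega] with x hx
  have h1 := hL x hx
  have h2 := two_mul_le_add_sq |a| |f x|
  rw [sq_abs, sq_abs] at h2
  rw [norm_mul, norm_mul, Real.norm_eq_abs, Real.norm_eq_abs, Real.norm_eq_abs]
  calc |a| * (|L x| * |f x|) = |L x| * (|a| * |f x|) := by ring
    _ ≤ η * w x * ((a ^ 2 + f x ^ 2) / 2) :=
        mul_le_mul h1 (by linarith) (by positivity) ((abs_nonneg _).trans h1)
    _ = _ := by ring

/-- Schur's test for kernels dominated by a strip around the lines `x · θ(φ) = s`. -/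
theorem abs_integral_mul_integral_kernel_le {ρ η : ℝ} (hρ : 0 ≤ ρ) (hη : 0 ≤ η)
    {L : Plane → ℝ × ℝ → ℝ} (hL : ∀ x ∈ Omega, ∀ y ∈ Omega', |L x y| ≤
      η * window ρ (inner ℝ x (theta y.2) - y.1))
    {f : Plane → ℝ} (hf : Integrable (fun x => f x ^ 2) (volume.restrict Omega)) {g : ℝ × ℝ → ℝ}
    (hg : Integrable (fun y => g y ^ 2) (volume.restrict Omega')) :
    |∫ y in Omega', g y * ∫ x in Omega, L x y * f x| ≤
      2 * Real.pi * η * ρ * ((∫ x in Omega, f x ^ 2) + ∫ y in Omega', g y ^ 2) := by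
  obtain ⟨i1, b1⟩ := integral_window_mul_sq_right_le hρ hf
  obtain ⟨i2, b2⟩ := integral_window_mul_sq_left_le hρ hg
  have i12 : Integrable (fun z : (ℝ × ℝ) × Plane =>
      η / 2 * (window ρ (inner ℝ z.2 (theta z.1.2) - z.1.1) * f z.2 ^ 2 +
        window ρ (inner ℝ z.2 (theta z.1.2) - z.1.1) * g z.1 ^ 2))
      ((volume.restrict Omega').prod (volume.restrict Omega)) := (i1.add i2).const_mul (η / 2)
  have hpt : ∀ y ∈ Omega', ‖g y * ∫ x in Omega, L x y * f x‖ ≤ ∫ x in Omega,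
      η / 2 * (window ρ (inner ℝ x (theta y.2) - y.1) * f x ^ 2 +
        window ρ (inner ℝ x (theta y.2) - y.1) * g y ^ 2) := fun y hy =>
    norm_mul_integral_kernel_le ((measurable_window_proj ρ).comp measurable_prodMk_right)
      (fun x => window_nonneg _ _) (fun x => window_le_one _ _) (fun x hx => hL x hx y hy) hf (g y)
  have main₀ : |∫ y in Omega', g y * ∫ x in Omega, L x y * f x| ≤ ∫ y in Omega', ∫ x in Omega,
      η / 2 * (window ρ (inner ℝ x (theta y.2) - y.1) * f x ^ 2 +
        window ρ (inner ℝ x (theta y.2) - y.1) * g y ^ 2) :=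
    norm_integral_le_of_norm_le (f := fun y => g y * ∫ x in Omega, L x y * f x)
      i12.integral_prod_left ((ae_restrict_mem measurableSet_Omega').mono hpt)
  have main := main₀.trans_eq (integral_prod _ i12).symm
  rw [integral_const_mul, integral_add i1 i2] at main
  have hg0 : 0 ≤ ∫ y in Omega', g y ^ 2 := integral_nonneg fun _ => sq_nonneg _
  have hle : 4 * ρ * (∫ y in Omega', g y ^ 2) ≤ 4 * Real.pi * ρ * ∫ y in Omega', g y ^ 2 := by
    refine mul_le_mul_of_nonneg_right ?_ hg0
    have := Real.pi_gt_three
    nlinarith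
  refine main.trans ?_
  calc _ ≤ η / 2 * (4 * Real.pi * ρ * (∫ x in Omega, f x ^ 2) +
          4 * Real.pi * ρ * ∫ y in Omega', g y ^ 2) := by
        refine mul_le_mul_of_nonneg_left (add_le_add b1 (b2.trans hle)) (by positivity)
    _ = _ := by ring

theorem inner_eq_mul (a b : ℝ) : inner ℝ a b = a * b := by
  simp [mul_comm]

/-! ### The error of the discrete backprojection -/

/-- The constant in the estimate of the offset discretization. -/
def offsetConst : ℝ :=
  Real.exp 1 * ((10 * √Real.pi + 36 * √(2 * Real.pi)) * (2 * Real.pi ^ 2))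

theorem offsetConst_pos : 0 < offsetConst := by
  have := Real.pi_pos
  unfold offsetConst; positivity

namespace Grid

variable {D : Grid} {g : ℝ × ℝ → ℝ}

theorem backError_eq (D : Grid) (hg : BddSinogram g) {x : Plane} (hx : x ∈ Omega) :
    backError D.δs D.cellCenter g x =
      (∫ y in Omega', D.offsetKernel x y * g y) - backprojectionFun g x := by
  obtain ⟨K, hK⟩ := hg.bounded
  have hδ := D.δs_pos
  have hm : Measurable fun y => D.offsetKernel x y * g y :=
    (D.measurable_offsetKernel.comp measurable_prodMk_left).mul hg.measurable
  have hi : Integrable (fun y => D.offsetKernel x y * g y) (volume.restrict Omega') := by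
    refine (integrable_const (1 / D.δs * K)).mono' hm.aestronglyMeasurable
      (ae_of_all _ fun y => ?_)
    rw [norm_mul]
    exact mul_le_mul (D.abs_offsetKernel_le x y) (hK y) (norm_nonneg _) (by positivity)
  have hs : ∀ φ, ∫ s in Set.Ioo (-1) 1, D.offsetKernel x (s, φ) * g (s, φ) =
      smear D.δs D.cellCenter (fun s => g (s, φ)) (inner ℝ x (theta φ)) := by
    intro φ
    refine setIntegral_eq_integral_of_forall_compl_eq_zero fun s hs => ?_
    rw [hg.support _ fun h => hs h.1, mul_zero]
  rw [restrict_Omega'] at hi ⊢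
  have hi2 := hi.integral_prod_right
  rw [integral_prod_symm _ hi]
  simp only [hs] at hi2 ⊢
  have hi3 : Integrable (fun φ => g (proj (x, φ))) angleMeasure :=
    (integrable_const K).mono' (hg.measurable.comp (measurable_proj.comp
      measurable_prodMk_left)).aestronglyMeasurable (ae_of_all _ fun φ => hK _)
  rw [backprojectionFun_eq g hx, ← integral_sub hi2 hi3]
  rfl

theorem integrable_bdd_mul_mul {L : Plane → ℝ × ℝ → ℝ}
    (hLm : Measurable fun z : Plane × (ℝ × ℝ) => L z.1 z.2) {K : ℝ}
    (hL : ∀ x ∈ Omega, ∀ y ∈ Omega', |L x y| ≤ K) {f : Plane → ℝ}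
    (hf : Integrable f (volume.restrict Omega)) (hg : BddSinogram g) :
    Integrable (Function.uncurry fun (y : ℝ × ℝ) (x : Plane) => g y * (L x y * f x))
      ((volume.restrict Omega').prod (volume.restrict Omega)) := by
  obtain ⟨K', hK'⟩ := hg.bounded
  have hmem : ∀ᵐ z ∂((volume : Measure (ℝ × ℝ)).restrict Omega').prod
      ((volume : Measure Plane).restrict Omega), z ∈ Omega' ×ˢ Omega := by
    rw [Measure.prod_restrict]
    exact ae_restrict_mem (measurableSet_Omega'.prod measurableSet_Omega)
  refine ((hf.comp_snd (volume.restrict Omega')).bdd_mul (c := K' * K)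
    (f := fun z : (ℝ × ℝ) × Plane => g z.1 * L z.2 z.1) ?_ ?_).congr (ae_of_all _ fun z => ?_)
  · exact ((hg.measurable.comp measurable_fst).mul
      (hLm.comp measurable_swap)).aestronglyMeasurable
  · filter_upwards [hmem] with z hz
    rw [norm_mul]
    exact mul_le_mul (hK' _) (hL _ hz.2 _ hz.1) (norm_nonneg _) ((abs_nonneg _).trans (hK' 0))
  · simp only [Function.uncurry]; ring

theorem Compatible.abs_kernel_sub_le' (hD : D.Compatible) {x : Plane} (hx : x ∈ Omega)
    {y : ℝ × ℝ} (hy : y ∈ Omega') :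
    |D.kernel x y - D.offsetKernel x y| ≤ (D.δx + D.δφ) / D.δs ^ 2 := by
  have := D.δφ_nonneg
  have := D.δx_pos
  exact (hD.abs_kernel_sub_le hx hy).trans
    (mul_le_of_le_one_right (by positivity) (window_le_one _ _))

theorem Compatible.integral_discreteRadonFun_mul_sub (hD : D.Compatible) (hg : BddSinogram g)
    {f : Plane → ℝ} (hf : Integrable f (volume.restrict Omega)) (hfb : Integrable
      (fun x => f x * backprojectionFun g x) (volume.restrict Omega)) :
    (∫ y in Omega', g y * D.discreteRadonFun f y) - ∫ x in Omega, f x * backprojectionFun g x =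
      (∫ y in Omega', g y * ∫ x in Omega, (D.kernel x y - D.offsetKernel x y) * f x) +
        ∫ x in Omega, f x * backError D.δs D.cellCenter g x := by
  have hm := D.measurable_kernel.sub D.measurable_offsetKernel
  have i1 := integrable_bdd_mul_mul (g := g) hm (fun x hx y hy => hD.abs_kernel_sub_le' hx hy) hf hg
  have i2 := integrable_bdd_mul_mul (g := g) D.measurable_offsetKernel
    (fun x _ y _ => D.abs_offsetKernel_le x y) hf hg
  have k1 : Integrable (fun y => ∫ x in Omega, g y *
      ((D.kernel x y - D.offsetKernel x y) * f x)) (volume.restrict Omega') := i1.integral_prod_left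
  have k2 : Integrable (fun y => ∫ x in Omega, g y * (D.offsetKernel x y * f x))
      (volume.restrict Omega') := i2.integral_prod_left
  have k3 : Integrable (fun x => ∫ y in Omega', g y * (D.offsetKernel x y * f x))
      (volume.restrict Omega) := i2.integral_prod_right
  have e1 : ∀ y ∈ Omega', g y * D.discreteRadonFun f y =
      (∫ x in Omega, g y * ((D.kernel x y - D.offsetKernel x y) * f x)) +
        ∫ x in Omega, g y * (D.offsetKernel x y * f x) := by
    intro y hy
    have j1 : Integrable (fun x => (D.kernel x y - D.offsetKernel x y) * f x)
        (volume.restrict Omega) :=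
      hf.bdd_mul (hm.comp measurable_prodMk_right).aestronglyMeasurable
        ((ae_restrict_mem measurableSet_Omega).mono fun x hx => hD.abs_kernel_sub_le' hx hy)
    have j2 : Integrable (fun x => D.offsetKernel x y * f x) (volume.restrict Omega) :=
      hf.bdd_mul (D.measurable_offsetKernel.comp measurable_prodMk_right).aestronglyMeasurable
        (ae_of_all _ fun x => D.abs_offsetKernel_le x y)
    rw [integral_const_mul, integral_const_mul, ← mul_add, ← integral_add j1 j2,
      D.discreteRadonFun_eq_integral hf]
    congr 1
    refine integral_congr_ae (ae_of_all _ fun x => ?_)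
    simp only; ring
  have e2 : ∀ x ∈ Omega, f x * backError D.δs D.cellCenter g x =
      (∫ y in Omega', g y * (D.offsetKernel x y * f x)) - f x * backprojectionFun g x := by
    intro x hx
    rw [D.backError_eq hg hx, mul_sub, ← integral_const_mul]
    congr 1
    refine integral_congr_ae (ae_of_all _ fun y => ?_)
    simp only; ring
  rw [setIntegral_congr_fun measurableSet_Omega' e1, setIntegral_congr_fun measurableSet_Omega e2,
    integral_add k1 k2, integral_sub k3 hfb, integral_integral_swap i2]
  simp only [integral_const_mul]
  ring

/-- The bound for the operator norm of the error. -/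
def errorBound (D : Grid) : ℝ :=
  4 * Real.pi * ((D.δx + D.δφ) / D.δs ^ 2) * (3 / 2 * D.δs + (D.δx + D.δφ)) +
    √(offsetConst * D.δs)

theorem errorBound_nonneg (D : Grid) : 0 ≤ D.errorBound := by
  have := D.δφ_nonneg
  have := D.δx_pos
  have := D.δs_pos
  have := Real.pi_pos
  unfold errorBound; positivity

theorem abs_integral_mul_backError_le (D : Grid) (hg : BddSinogram g) {f : Plane → ℝ}
    (hf : Integrable (fun x => f x ^ 2) (volume.restrict Omega)) :
    |∫ x in Omega, f x * backError D.δs D.cellCenter g x| ≤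
      √(offsetConst * D.δs) / 2 * ((∫ x in Omega, f x ^ 2) + ∫ y in Omega', g y ^ 2) := by
  have hl0 : 0 < offsetConst * D.δs := mul_pos offsetConst_pos D.δs_pos
  obtain ⟨i, b⟩ := hg.setIntegral_backError_sq_le D.δs_pos D.measurable_cellCenter
    D.abs_cellCenter_sub_le
  set l := √(offsetConst * D.δs) with hl
  have hlp : 0 < l := Real.sqrt_pos.2 hl0
  have hl2 : offsetConst * D.δs = l ^ 2 := (Real.sq_sqrt hl0.le).symm
  change _ ≤ offsetConst * D.δs * _ at b
  have hdom : Integrable (fun x => l / 2 * f x ^ 2 +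
      1 / (2 * l) * backError D.δs D.cellCenter g x ^ 2) (volume.restrict Omega) :=
    (hf.const_mul _).add (i.const_mul _)
  have main : |∫ x in Omega, f x * backError D.δs D.cellCenter g x| ≤
      ∫ x in Omega, (l / 2 * f x ^ 2 + 1 / (2 * l) * backError D.δs D.cellCenter g x ^ 2) :=
    norm_integral_le_of_norm_le (f := fun x => f x * backError D.δs D.cellCenter g x) hdom
      (ae_of_all _ fun x => by
      have h := sq_nonneg (l * |f x| - |backError D.δs D.cellCenter g x|)
      rw [norm_mul, Real.norm_eq_abs, Real.norm_eq_abs, ← sq_abs (f x),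
        ← sq_abs (backError D.δs D.cellCenter g x)]
      have e : l / 2 * |f x| ^ 2 + 1 / (2 * l) * |backError D.δs D.cellCenter g x| ^ 2 -
        |f x| * |backError D.δs D.cellCenter g x| =
          (l * |f x| - |backError D.δs D.cellCenter g x|) ^ 2 / (2 * l) := by
        field_simp; ring
      have := div_nonneg h (by positivity : 0 ≤ 2 * l)
      linarith)
  rw [integral_add (hf.const_mul _) (i.const_mul _), integral_const_mul, integral_const_mul] at main
  rw [hl2] at b
  have b' := mul_le_mul_of_nonneg_left b (by positivity : 0 ≤ 1 / (2 * l))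
  have e : 1 / (2 * l) * (l ^ 2 * ∫ y in Omega', g y ^ 2) = l / 2 * ∫ y in Omega', g y ^ 2 := by
    field_simp
  linarith

theorem Compatible.abs_form_le (hD : D.Compatible) (hg : BddSinogram g)
    {f : Plane → ℝ} (hf : MemLp f 2 (volume.restrict Omega)) (hfb : Integrable
      (fun x => f x * backprojectionFun g x) (volume.restrict Omega)) :
    |(∫ y in Omega', g y * D.discreteRadonFun f y) -
      ∫ x in Omega, f x * backprojectionFun g x| ≤
      D.errorBound / 2 * ((∫ x in Omega, f x ^ 2) + ∫ y in Omega', g y ^ 2) := by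
  have h1 := D.δφ_nonneg
  have h2 := D.δx_pos
  have h3 := D.δs_pos
  obtain ⟨K, hK⟩ := hg.bounded
  have hg2 : Integrable (fun y => g y ^ 2) (volume.restrict Omega') :=
    (integrable_const (K ^ 2)).mono' (hg.measurable.pow_const 2).aestronglyMeasurable
      (ae_of_all _ fun y => by
        rw [Real.norm_eq_abs, abs_of_nonneg (sq_nonneg _)]
        exact sq_le_sq' (abs_le.1 (hK _)).1 (abs_le.1 (hK _)).2)
  rw [hD.integral_discreteRadonFun_mul_sub hg (hf.integrable (by norm_num)) hfb]
  refine (abs_add_le _ _).trans ((add_le_add (abs_integral_mul_integral_kernel_le (by positivity)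
    (by positivity) (fun x hx y hy => hD.abs_kernel_sub_le hx hy)
    hf.integrable_sq hg2)
    (D.abs_integral_mul_backError_le hg hf.integrable_sq)).trans (le_of_eq ?_))
  unfold errorBound
  ring

theorem Compatible.abs_inner_le_of_simple (hD : D.Compatible) (f : L2Omega)
    (G : Lp.simpleFunc ℝ 2 ((volume : Measure (ℝ × ℝ)).restrict Omega')) :
    |inner ℝ f ((ContinuousLinearMap.adjoint D.discreteRadon - backprojection) (G : L2Omega'))| ≤
      D.errorBound / 2 * (‖f‖ ^ 2 + ‖(G : L2Omega')‖ ^ 2) := by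
  set S := Lp.simpleFunc.toSimpleFunc G
  set g : ℝ × ℝ → ℝ := Omega'.indicator S with hgdef
  have hg : BddSinogram g := by
    obtain ⟨K, hK⟩ := S.exists_forall_norm_le
    refine ⟨S.measurable.indicator measurableSet_Omega', ⟨K, fun y => ?_⟩, fun y hy =>
      Set.indicator_of_notMem hy _⟩
    exact (norm_indicator_le_norm_self _ _).trans (hK y)
  have hGg : (G : L2Omega') =ᵐ[(volume : Measure (ℝ × ℝ)).restrict Omega'] g := by
    filter_upwards [Lp.simpleFunc.toSimpleFunc_eq_toFun G,
      ae_restrict_mem measurableSet_Omega'] with y h1 h2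
    rw [hgdef, Set.indicator_of_mem h2, h1]
  have hb : backprojection (G : L2Omega') =ᵐ[(volume : Measure Plane).restrict Omega]
      backprojectionFun g := by
    filter_upwards [backprojection_ae_eq (G : L2Omega'), backprojectionFun_ae_eq (G : L2Omega'),
      backprojectionFun_ae_eq g, ae_ae_of_ae_Omega' hGg] with x h1 h2 h3 h4
    rw [h1, h2, h3]
    exact integral_congr_ae h4
  have hf := Lp.memLp f
  have i1 : inner ℝ f (backprojection (G : L2Omega')) =
      ∫ x in Omega, f x * backprojectionFun g x := by
    rw [L2.inner_def]
    refine integral_congr_ae ?_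
    filter_upwards [hb] with x hx
    rw [hx, inner_eq_mul]
  have i2 : inner ℝ (D.discreteRadon f) (G : L2Omega') =
      ∫ y in Omega', g y * D.discreteRadonFun f y := by
    rw [L2.inner_def]
    refine integral_congr_ae ?_
    filter_upwards [hGg, D.discreteRadon_ae_eq f] with y h1 h2
    rw [h1, h2, inner_eq_mul, mul_comm]
  have n1 : ‖f‖ ^ 2 = ∫ x in Omega, f x ^ 2 := by
    rw [← real_inner_self_eq_norm_sq, L2.inner_def]
    refine integral_congr_ae (ae_of_all _ fun x => ?_)
    simp only
    rw [inner_eq_mul, pow_two]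
  have n2 : ‖(G : L2Omega')‖ ^ 2 = ∫ y in Omega', g y ^ 2 := by
    rw [← real_inner_self_eq_norm_sq, L2.inner_def]
    refine integral_congr_ae ?_
    filter_upwards [hGg] with y h1
    rw [inner_eq_mul, h1, pow_two]
  have hfb : Integrable (fun x => f x * backprojectionFun g x) (volume.restrict Omega) := by
    refine (hf.integrable_mul (Lp.memLp (backprojection (G : L2Omega')))).congr ?_
    filter_upwards [hb] with x hx
    rw [Pi.mul_apply, hx]
  rw [sub_apply, inner_sub_right, ContinuousLinearMap.adjoint_inner_right,
    i1, i2, n1, n2]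
  exact hD.abs_form_le hg hf hfb

theorem Compatible.norm_adjoint_sub_le (hD : D.Compatible) :
    ‖ContinuousLinearMap.adjoint D.discreteRadon - backprojection‖ ≤ D.errorBound := by
  set B := ContinuousLinearMap.adjoint D.discreteRadon - backprojection with hB
  have hall : ∀ (f : L2Omega) (G : L2Omega'),
      |inner ℝ f (B G)| ≤ D.errorBound / 2 * (‖f‖ ^ 2 + ‖G‖ ^ 2) := by
    intro f G
    have hclosed : IsClosed {G : L2Omega' | |inner ℝ f (B G)| ≤
        D.errorBound / 2 * (‖f‖ ^ 2 + ‖G‖ ^ 2)} := by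
      refine isClosed_le ?_ (by fun_prop)
      exact (continuous_const.inner B.continuous).abs
    have hdense : Dense ((Lp.simpleFunc ℝ 2 ((volume : Measure (ℝ × ℝ)).restrict Omega') :
        AddSubgroup L2Omega') : Set L2Omega') := Lp.simpleFunc.dense (by norm_num)
    have hsub : closure ((Lp.simpleFunc ℝ 2 ((volume : Measure (ℝ × ℝ)).restrict Omega') :
        AddSubgroup L2Omega') : Set L2Omega') ⊆ _ :=
      hclosed.closure_subset_iff.2 fun G' hG' => hD.abs_inner_le_of_simple f ⟨G', hG'⟩
    exact hsub (hdense G)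
  have hC := D.errorBound_nonneg
  refine ContinuousLinearMap.opNorm_le_of_unit_norm hC fun G hG => ?_
  rcases eq_or_ne (B G) 0 with h0 | h0
  · rw [h0, norm_zero]; exact hC
  have hn : 0 < ‖B G‖ := norm_pos_iff.2 h0
  have h := hall ((‖B G‖)⁻¹ • B G) G
  rw [real_inner_smul_left, real_inner_self_eq_norm_sq, norm_smul, norm_inv, norm_norm,
    inv_mul_cancel₀ hn.ne', hG, pow_two, ← mul_assoc, inv_mul_cancel₀ hn.ne', one_mul,
    abs_of_pos hn] at h
  linarith

end Grid

end PixelRadon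

end

/-- Let `D i` be discretizations compatible with `Ω` and `Ω'`, with `δ_s → 0`, `δ_φ / δ_s → 0`
and `δ_x / δ_s → 0` along a filter `l`. Then the adjoints of the fully discrete Radon transforms
converge to the backprojection in operator norm `L²(Ω') → L²(Ω)`; if moreover `δ_φ` and `δ_x` are
`O(δ_s ^ (1 + ε))` with `0 < ε ≤ 1/2`, the error is `O(δ_s ^ ε)`. -/
theorem corollary2p8 {ι : Type*} (l : Filter ι) (D : ι → PixelRadon.Grid)
    (hD : ∀ i, (D i).Compatible)
    (hs : Tendsto (fun i => (D i).δs) l (𝓝 0))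
    (hφ : Tendsto (fun i => (D i).δφ / (D i).δs) l (𝓝 0))
    (hx : Tendsto (fun i => (D i).δx / (D i).δs) l (𝓝 0)) :
    Tendsto (fun i => ‖ContinuousLinearMap.adjoint (D i).discreteRadon -
        PixelRadon.backprojection‖) l (𝓝 0) ∧
      ∀ ε : ℝ, 0 < ε → ε ≤ 1 / 2 →
        (fun i => (D i).δφ) =O[l] (fun i => (D i).δs ^ (1 + ε)) →
        (fun i => (D i).δx) =O[l] (fun i => (D i).δs ^ (1 + ε)) →
        (fun i => ‖ContinuousLinearMap.adjoint (D i).discreteRadon -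
            PixelRadon.backprojection‖) =O[l] (fun i => (D i).δs ^ ε) := by
  have hpos : ∀ i, 0 < (D i).δs := fun i => (D i).δs_pos
  set r : ι → ℝ := fun i => (D i).δx / (D i).δs + (D i).δφ / (D i).δs with hr
  have hr0 : Tendsto r l (𝓝 0) := by simpa using hx.add hφ
  have hle : ∀ i, ‖ContinuousLinearMap.adjoint (D i).discreteRadon -
      PixelRadon.backprojection‖ ≤ 4 * Real.pi * r i * (3 / 2 + r i) +
        √(PixelRadon.offsetConst * (D i).δs) := by
    intro i
    refine (hD i).norm_adjoint_sub_le.trans (le_of_eq ?_)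
    have := (hpos i).ne'
    simp only [hr, PixelRadon.Grid.errorBound]
    field_simp
  have hlim : Tendsto (fun i => 4 * Real.pi * r i * (3 / 2 + r i) +
      √(PixelRadon.offsetConst * (D i).δs)) l (𝓝 0) := by
    have h1 := (hr0.const_mul (4 * Real.pi)).mul (hr0.const_add (3 / 2))
    have h2 := (hs.const_mul PixelRadon.offsetConst).sqrt
    simpa using h1.add h2
  refine ⟨squeeze_zero (fun _ => norm_nonneg _) hle hlim, fun ε hε hε' hφO hxO => ?_⟩
  have hdiv : ∀ {u : ι → ℝ}, u =O[l] (fun i => (D i).δs ^ (1 + ε)) →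
      (fun i => u i / (D i).δs) =O[l] (fun i => (D i).δs ^ ε) := by
    intro u hu
    have h := hu.mul (isBigO_refl (fun i => ((D i).δs)⁻¹) l)
    refine h.congr (fun i => (div_eq_mul_inv _ _).symm) fun i => ?_
    rw [Real.rpow_add (hpos i), Real.rpow_one, mul_comm, ← mul_assoc,
      inv_mul_cancel₀ (hpos i).ne', one_mul]
  have hrO : r =O[l] (fun i => (D i).δs ^ ε) := (hdiv hxO).add (hdiv hφO)
  have h32 : (fun i => 3 / 2 + r i) =O[l] (fun _ => (1 : ℝ)) := (hr0.const_add (3 / 2)).isBigO_one ℝ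
  have h1 : (fun i => 4 * Real.pi * r i * (3 / 2 + r i)) =O[l] (fun i => (D i).δs ^ ε) := by
    simpa using (hrO.const_mul_left (4 * Real.pi)).mul h32
  have h2 : (fun i => √(PixelRadon.offsetConst * (D i).δs)) =O[l] (fun i => (D i).δs ^ ε) := by
    refine IsBigO.of_bound √PixelRadon.offsetConst ?_
    filter_upwards [hs.eventually (gt_mem_nhds one_pos)] with i hi
    rw [Real.norm_eq_abs, Real.norm_eq_abs, abs_of_nonneg (Real.sqrt_nonneg _),
      abs_of_nonneg (Real.rpow_nonneg (hpos i).le _),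
      Real.sqrt_mul PixelRadon.offsetConst_pos.le]
    refine mul_le_mul_of_nonneg_left ?_ (Real.sqrt_nonneg _)
    rw [Real.sqrt_eq_rpow]
    exact Real.rpow_le_rpow_of_exponent_ge (hpos i) hi.le hε'
  refine IsBigO.trans (IsBigO.of_bound 1 (Eventually.of_forall fun i => ?_)) (h1.add h2)
  rw [norm_norm, one_mul]
  exact (hle i).trans (le_abs_self _)
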